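/- **Setting.** Let $\mathbb T=\mathbb R/2\pi\mathbb Z$ with distance $|u-v|=\min_{n\in\mathbb Z}|u-v+2\pi n|$. For $m\ge 1$ let $I(m)=\{-\frac{m-1}2,-\frac{m-1}2+1,\dots,\frac{m-1}2\}$ and $\phi(t)=m^{-1/2}[e^{ikt}]_{k\in I(m)}\in\mathbb C^m$. For a subspace $W\subset\mathbb C^m$ with orthogonal projection $P_W$, its landscape function is $q_W(t)=1-\|P_W\phi(t)\|_2^2$, $t\in\mathbb T$. For $x=\{x_j\}_{j=1}^s\subset\mathbb T$ let $\Delta(x)=\min_{j\ne k}|x_j-x_k|$ ($+\infty$ if $s\le 1$), let $U$ be the range of the matrix $[e^{ikx_j}]_{k\in I(m),\,1\le j\le s}$, and for a subspace $\tilde U$ let $\vartheta(x,\tilde U)=\|P_U-P_{\tilde U}\|_2$. For finite $G\subset\mathbb T$ let $\mathrm{mesh}(G)=\max_{t\in\mathbb T}\min_{u\in G}|t-u|$. A set $V\subset G$ is a cluster in $G$ if any $v,w\in V$ satisfy $|v-w|<\pi$ and all points of $G$ on the shorter arc between $v$ and $w$ belong to $V$; the clusters of a set $A\subset G$ are the maximal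 nonempty subsets of $A$ that are clusters in $G$. **Gradient-MUSIC.** Given a subspace $\tilde U$ of dimension $s$, a finite $G\subset\mathbb T$, a threshold $\alpha$, a step size $h$ and a number $n$ of iterations, put $\tilde q=q_{\tilde U}$ and form $A=\{u\in G:\tilde q(u)<\alpha\}$; pick an arbitrary representative $t_{j,0}$ in each of the $s$ clusters of $A$; run $t_{j,k+1}=t_{j,k}-h\,\tilde q\,'(t_{j,k})$ and output $\hat x_j=t_{j,n}$, $j=1,\dots,s$. **Theorem (Gradient-MUSIC performance guarantee).** Let $m\ge 100$, $\alpha=0.529$, $G\subset\mathbb T$ finite with $\mathrm{mesh}(G)\le 1/(2m)$, and $h=6/m^2$. Let $x=\{x_j\}_{j=1}^s\subset\mathbb T$ with $\Delta(x)\ge 8\pi/m$ and let $\tilde U\subset\mathbb C^m$ be a subspace of dimension $s$ with $\vartheta:=\vartheta(x,\tilde U)\le 0.01$. Then: 1. $A$ has exactly $s$ clusters; they are pairwise disjoint and their union is $A$. 2. The clusters can be enumerated as $A_1,\dots,A_s$ so that for each $j$ there is a local minimum $\tilde x_j$ of $\tilde q$ with $|x_j-\tilde x_j|\le 7\vartheta/m$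 such that, for every starting point $t_{j,0}\in A_j$, gradient descent satisfies $$|t_{j,k}-\tilde x_j|\le \frac{77\pi\,(0.839)^k}{m}\qquad\text{for all }k\ge 31 .$$ 3. For every $n\ge 31$, Gradient-MUSIC has an output, and every output $\hat x$ (whatever representatives are chosen), indexed to best match $x$, satisfies $$\max_{1\le j\le s}|x_j-\hat x_j|\le \frac{7\vartheta}{m}+\frac{77\pi\,(0.839)^n}{m}.$$ -/

import Mathlib

open Real Set
open scoped ENNReal NNReal Matrix

noncomputable section

namespace GradientMUSIC

/-- The torus `ℝ / 2πℤ`. Mathlib's metric on it is `|u - v| = min_{n ∈ ℤ} |u - v + 2πn|`. -/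
abbrev Torus : Type := AddCircle (2 * π)

instance instFactTwoPiPos : Fact (0 < 2 * π) := ⟨Real.two_pi_pos⟩

/-- The representative in `(-π, π]` of a point of the torus. -/
def rep (t : Torus) : ℝ := (AddCircle.equivIoc (2 * π) (-π) t : ℝ)

/-- The `k`-th element `-(n-1)/2 + k` of the symmetric, unit-spaced index set `I(n)`. -/
def freqIndex (n : ℕ) (k : Fin n) : ℝ := (k : ℝ) - ((n : ℝ) - 1) / 2

/-- The nonharmonic Fourier matrix `Φ(n, x) = [exp(i k x_j)]_{k ∈ I(n), j}`. (For even `n` the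
indices are half-integers: another choice of representatives of the `x_j` multiplies columns by
`-1`, which does not change the range.) -/
def fourierMatrix (n : ℕ) {s : ℕ} (x : Fin s → Torus) : Matrix (Fin n) (Fin s) ℂ :=
  Matrix.of fun k j => Complex.exp (Complex.I * (freqIndex n k : ℂ) * (rep (x j) : ℂ))

/-- The Fourier subspace of `ℂᵐ` generated by `x`: the range (column span) of `Φ(m, x)`. -/
def fourierSubspace (m : ℕ) {s : ℕ} (x : Fin s → Torus) :
    Submodule ℂ (EuclideanSpace ℂ (Fin m)) :=
  Submodule.span ℂ (range fun j : Fin s => WithLp.toLp 2 ((fourierMatrix m x)ᵀ j))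

/-- The normalized steering vector `φ(t) = m^{-1/2} [exp(i k t)]_{k ∈ I(m)}`. -/
def steering (m : ℕ) (t : Torus) : EuclideanSpace ℂ (Fin m) :=
  WithLp.toLp 2 fun k =>
    ((1 / √(m : ℝ) : ℝ) : ℂ) * Complex.exp (Complex.I * (freqIndex m k : ℂ) * (rep t : ℂ))

/-- The landscape function `q_W(t) = 1 - ‖W* φ(t)‖₂²` of a subspace `W` of `ℂᵐ`. If the columns of
a matrix `W` are an orthonormal basis of the subspace, then `W W*` is the orthogonal projection
onto it and `‖W* v‖₂ = ‖W W* v‖₂`. -/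
def landscape {m : ℕ} (W : Submodule ℂ (EuclideanSpace ℂ (Fin m))) (t : Torus) : ℝ :=
  1 - ‖W.starProjection (steering m t)‖ ^ 2

/-- The sine-theta distance `‖V V* - W W*‖₂`: the operator norm of the difference of the orthogonal
projections. -/
def sinTheta {m : ℕ} (V W : Submodule ℂ (EuclideanSpace ℂ (Fin m))) : ℝ :=
  ‖V.starProjection - W.starProjection‖

/-- The subspace error between frequencies `x` and a subspace `W`. -/
def subspaceError {m s : ℕ} (x : Fin s → Torus)
    (W : Submodule ℂ (EuclideanSpace ℂ (Fin m))) : ℝ :=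
  sinTheta (fourierSubspace m x) W

/-- The minimum separation `Δ(x) = min_{j ≠ k} |x_j - x_k|` (`∞` if there are no two indices). -/
def minSep {s : ℕ} (x : Fin s → Torus) : ℝ≥0∞ :=
  ⨅ (j : Fin s) (k : Fin s) (_ : j ≠ k), edist (x j) (x k)

/-- The mesh norm `max_t min_{u ∈ G} |t - u|` (`∞` if `G` is empty). -/
def mesh (G : Set Torus) : ℝ≥0∞ := ⨆ t : Torus, Metric.infEDist t G

/-- The accepted points of the grid `G` at threshold `α`. -/
def accepted (f : Torus → ℝ) (G : Set Torus) (α : ℝ) : Set Torus := {u ∈ G | f u < α}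

/-- The (closed) shorter arc between `v` and `w`; used when `|v - w| < π`. -/
def shortArc (v w : Torus) : Set Torus :=
  (fun r : ℝ => v + ((r * rep (w - v) : ℝ) : Torus)) '' Icc 0 1

/-- A subset `V` of `G` is a cluster in `G` if any two of its points are less than `π` apart and
the path in `G` connecting them (all points of `G` on the shorter arc) is contained in `V`. -/
def IsCluster (G V : Set Torus) : Prop :=
  V ⊆ G ∧ ∀ v ∈ V, ∀ w ∈ V, dist v w < π ∧ G ∩ shortArc v w ⊆ V

/-- The clusters of `A ⊆ G`: the nonempty subsets of `A` that are clusters in `G` and that are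
maximal with this property, i.e. the connected components of `A` in `G`. -/
def clustersOf (G A : Set Torus) : Set (Set Torus) :=
  {V | V.Nonempty ∧ Maximal (fun V' : Set Torus => V' ⊆ A ∧ IsCluster G V') V}

/-- The derivative of a real function on the torus. -/
def torusDeriv (f : Torus → ℝ) (t : Torus) : ℝ := deriv (fun u : ℝ => f (t + (u : Torus))) 0

/-- `k` steps of gradient descent `t ↦ t - h f'(t)` on the torus, started at `t₀`. -/
def gradIter (f : Torus → ℝ) (h : ℝ) (t₀ : Torus) : ℕ → Torus
  | 0 => t₀
  | k + 1 => gradIter f h t₀ k - ((h * torusDeriv f (gradIter f h t₀ k) : ℝ) : Torus)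

/-- `xhat` is a possible output of Gradient-MUSIC, given the subspace `W` and the sparsity `s`, with
grid `G`, threshold `α`, step size `h` and `n` iterations: the accepted points have exactly `s`
clusters `C 1, …, C s`, and `xhat j` is the `n`-th gradient descent iterate started from some
representative `t₀ j` of the cluster `C j`. -/
def IsOutput {m : ℕ} (s : ℕ) (W : Submodule ℂ (EuclideanSpace ℂ (Fin m))) (G : Set Torus)
    (α h : ℝ) (n : ℕ) (xhat : Fin s → Torus) : Prop :=
  ∃ (C : Fin s → Set Torus) (t₀ : Fin s → Torus),
    Function.Injective C ∧ range C = clustersOf G (accepted (landscape W) G α) ∧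
    ∀ j, t₀ j ∈ C j ∧ xhat j = gradIter (landscape W) h (t₀ j) n

end GradientMUSIC

end

/-!
Displacements `u` on the torus are measured by `y = m u / 2`, so that the steering vector becomes
a curve (`wave`) whose inner products are values of the normalised Dirichlet kernel
`kern y = sin y / (m sin (y / m))`, and a gradient step of size `6 / m²` becomes a step of size
`3 / 2` in `y`.

*Reduction to a frame bound.* Let `U` be the Fourier subspace of `x`, let `P` be the projection
onto it and `e = φ(x_j)`. Since `e ∈ U`, `‖P φ‖² = kern² + ‖P χ‖²`, where `χ` is the component of
the steering curve orthogonal to `e`. The terms coming from `χ` are controlled by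
`0.598 ‖P v‖² ≤ ∑ₖ |⟨φ(x_k), v⟩|²` (`norm_starProjection_sq_le`), which is dual to a lower Riesz
bound for the vectors `φ(x_k)` (`riesz_lower_bound`). The Dirichlet kernel decays too slowly for
Gershgorin's theorem; but weighting the coordinates by the window `cos (π κ / 2) ≤ 1` only
decreases the norm, and the windowed kernel decays quadratically, so that the weighted Gram matrix
is diagonally dominant when the frequencies are `8 π / m`-separated. All sums over frequencies are
compared with sums over arithmetic progressions (`sum_le_of_separated`, `sum_decay_le`).

*Near a frequency.* For `|y| ≤ 1.75` this gives `‖P χ'‖² ≤ 0.1`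
(`norm_starProjection_chi_one_sq_le`), and `χ` vanishes at `y = 0`. Replacing `U` by a subspace at
distance `ϑ` adds the quadratic form of the difference of the two projections, which together with
its derivatives is `O(ϑ)`. Hence the landscape is `1 - kern²` up to a small perturbation: its
derivative is `y T`, where `T ≥ 0.268`, up to an error of at most `0.201 |y| + 1.16 ϑ`, and it is
strongly convex for `|y| ≤ 0.4`. So there is a local minimum `z` with `|z| ≤ 3.5 ϑ`, and a
gradient step contracts the distance to `z` by `0.95` for `|y| ≤ 1.75` and by `0.839` for
`|y| ≤ 0.4` (`exists_localMin_contraction`, `exists_localMin_near`). As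
`0.95 ^ 31 * 1.785 < 0.365`, the second regime is reached after `31` steps
(`contraction_iterate`).

*Away from the frequencies.* If `|y| ≥ 1.75` for all of them, the frame bound shows that the
landscape is at least `0.529` (`landscape_ge_far`). So every accepted grid point lies within
`3.5 / m` of some `x_j`. The contraction property makes the landscape monotone on either side of
`z`, so the accepted points near `x_j` form a cluster; and grid points at distance about `4 π / m`
from `x_j` are rejected, so no cluster meets the neighbourhoods of two frequencies
(`clustersOf_eq_range`).
-/

namespace GradientMUSIC

open scoped InnerProductSpace

/-! ### Taylor bounds for sine and cosine -/

theorem le_of_deriv_le {f g f' g' : ℝ → ℝ} (hf : ∀ x, HasDerivAt f (f' x) x)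
    (hg : ∀ x, HasDerivAt g (g' x) x) (h0 : f 0 ≤ g 0) (h : ∀ x, 0 ≤ x → f' x ≤ g' x)
    {x : ℝ} (hx : 0 ≤ x) : f x ≤ g x := by
  have hd : ∀ t, HasDerivAt (fun t => g t - f t) (g' t - f' t) t := fun t => (hg t).sub (hf t)
  have hm : MonotoneOn (fun t => g t - f t) (Ici 0) := by
    refine monotoneOn_of_deriv_nonneg (convex_Ici 0)
      (fun t _ => (hd t).continuousAt.continuousWithinAt)
      (fun t _ => (hd t).differentiableAt.differentiableWithinAt) fun t ht => ?_
    rw [interior_Ici] at ht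
    rw [(hd t).deriv]
    linarith [h t (le_of_lt ht)]
  have h1 := hm (mem_Ici.2 le_rfl) (mem_Ici.2 hx) hx
  simp only at h1
  linarith

theorem cos_le_taylor_four {x : ℝ} (hx : 0 ≤ x) : cos x ≤ 1 - x ^ 2 / 2 + x ^ 4 / 24 := by
  have hp : ∀ t : ℝ, HasDerivAt (fun t => 1 - t ^ 2 / 2 + t ^ 4 / 24)
      (0 - (2 : ℕ) * t ^ (2 - 1) / 2 + (4 : ℕ) * t ^ (4 - 1) / 24) t := fun t =>
    ((hasDerivAt_const t 1).sub ((hasDerivAt_pow 2 t).div_const 2)).add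
      ((hasDerivAt_pow 4 t).div_const 24)
  refine le_of_deriv_le hasDerivAt_cos hp (by norm_num) (fun t ht => ?_) hx
  have := sin_ge_sub_cube ht
  norm_num
  linarith

theorem sin_le_taylor_five {x : ℝ} (hx : 0 ≤ x) : sin x ≤ x - x ^ 3 / 6 + x ^ 5 / 120 := by
  have hp : ∀ t : ℝ, HasDerivAt (fun t => t - t ^ 3 / 6 + t ^ 5 / 120)
      (1 - (3 : ℕ) * t ^ (3 - 1) / 6 + (5 : ℕ) * t ^ (5 - 1) / 120) t := fun t =>
    ((hasDerivAt_id t).sub ((hasDerivAt_pow 3 t).div_const 6)).add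
      ((hasDerivAt_pow 5 t).div_const 120)
  refine le_of_deriv_le hasDerivAt_sin hp (by norm_num) (fun t ht => ?_) hx
  have := cos_le_taylor_four ht
  norm_num
  linarith

theorem taylor_six_le_cos {x : ℝ} (hx : 0 ≤ x) :
    1 - x ^ 2 / 2 + x ^ 4 / 24 - x ^ 6 / 720 ≤ cos x := by
  have hp : ∀ t : ℝ, HasDerivAt (fun t => 1 - t ^ 2 / 2 + t ^ 4 / 24 - t ^ 6 / 720)
      (0 - (2 : ℕ) * t ^ (2 - 1) / 2 + (4 : ℕ) * t ^ (4 - 1) / 24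
        - (6 : ℕ) * t ^ (6 - 1) / 720) t := fun t =>
    (((hasDerivAt_const t 1).sub ((hasDerivAt_pow 2 t).div_const 2)).add
      ((hasDerivAt_pow 4 t).div_const 24)).sub ((hasDerivAt_pow 6 t).div_const 720)
  refine le_of_deriv_le hp hasDerivAt_cos (by norm_num) (fun t ht => ?_) hx
  have := sin_le_taylor_five ht
  norm_num
  linarith

theorem taylor_seven_le_sin {x : ℝ} (hx : 0 ≤ x) :
    x - x ^ 3 / 6 + x ^ 5 / 120 - x ^ 7 / 5040 ≤ sin x := by
  have hp : ∀ t : ℝ, HasDerivAt (fun t => t - t ^ 3 / 6 + t ^ 5 / 120 - t ^ 7 / 5040)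
      (1 - (3 : ℕ) * t ^ (3 - 1) / 6 + (5 : ℕ) * t ^ (5 - 1) / 120
        - (7 : ℕ) * t ^ (7 - 1) / 5040) t := fun t =>
    (((hasDerivAt_id t).sub ((hasDerivAt_pow 3 t).div_const 6)).add
      ((hasDerivAt_pow 5 t).div_const 120)).sub ((hasDerivAt_pow 7 t).div_const 5040)
  refine le_of_deriv_le hp hasDerivAt_sin (by norm_num) (fun t ht => ?_) hx
  have := taylor_six_le_cos ht
  norm_num
  linarith

theorem cos_le_taylor_eight {x : ℝ} (hx : 0 ≤ x) :
    cos x ≤ 1 - x ^ 2 / 2 + x ^ 4 / 24 - x ^ 6 / 720 + x ^ 8 / 40320 := by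
  have hp : ∀ t : ℝ, HasDerivAt
      (fun t => 1 - t ^ 2 / 2 + t ^ 4 / 24 - t ^ 6 / 720 + t ^ 8 / 40320)
      (0 - (2 : ℕ) * t ^ (2 - 1) / 2 + (4 : ℕ) * t ^ (4 - 1) / 24
        - (6 : ℕ) * t ^ (6 - 1) / 720 + (8 : ℕ) * t ^ (8 - 1) / 40320) t := fun t =>
    ((((hasDerivAt_const t 1).sub ((hasDerivAt_pow 2 t).div_const 2)).add
      ((hasDerivAt_pow 4 t).div_const 24)).sub ((hasDerivAt_pow 6 t).div_const 720)).add
      ((hasDerivAt_pow 8 t).div_const 40320)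
  refine le_of_deriv_le hasDerivAt_cos hp (by norm_num) (fun t ht => ?_) hx
  have := taylor_seven_le_sin ht
  norm_num
  linarith

/-- `1 / sin² z ≤ 1 / z² + 1`, which amounts to `z ≤ tan z`. -/
theorem inv_sin_sq_le {z : ℝ} (h0 : 0 < z) (h1 : z ≤ π / 2) : 1 / sin z ^ 2 ≤ 1 / z ^ 2 + 1 := by
  have hs : 0 < sin z := sin_pos_of_pos_of_lt_pi h0 (by linarith [pi_pos])
  have hc : 0 ≤ cos z := cos_nonneg_of_mem_Icc ⟨by linarith, h1⟩
  have hle : z * cos z ≤ sin z := by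
    rcases h1.lt_or_eq with h | h
    · have hc' : 0 < cos z := cos_pos_of_mem_Ioo ⟨by linarith, h⟩
      have := (lt_tan h0 h).le
      rw [tan_eq_sin_div_cos, le_div_iff₀ hc'] at this
      exact this
    · rw [h, cos_pi_div_two, mul_zero, ← h]; exact hs.le
  have h2 : (z * cos z) ^ 2 ≤ sin z ^ 2 := pow_le_pow_left₀ (by positivity) hle 2
  have h3 := sin_sq_add_cos_sq z
  rw [div_add_one (by positivity), div_le_div_iff₀ (by positivity) (by positivity)]
  nlinarith

/-! ### The normalised Dirichlet kernel -/

/-- The scaled frequencies `2 k / m`, `k ∈ I(m)`. In terms of them a displacement `u` on the torus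
is measured by `y = m u / 2`. -/
noncomputable def angFreq (m : ℕ) (l : Fin m) : ℝ := 2 * freqIndex m l / m

/-- The normalised Dirichlet kernel `sin y / (m sin (y / m))`, in the scaled variable `y = m u / 2`,
as a sum of cosines. -/
noncomputable def kern (m : ℕ) (y : ℝ) : ℝ := (1 / m) * ∑ l : Fin m, cos (angFreq m l * y)

/-- The derivative of `kern`. -/
noncomputable def kern1 (m : ℕ) (y : ℝ) : ℝ :=
  (1 / m) * ∑ l : Fin m, -(angFreq m l * sin (angFreq m l * y))

/-- The second derivative of `kern`. -/
noncomputable def kern2 (m : ℕ) (y : ℝ) : ℝ :=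
  (1 / m) * ∑ l : Fin m, -(angFreq m l ^ 2 * cos (angFreq m l * y))

theorem hasDerivAt_kern (m : ℕ) (y : ℝ) : HasDerivAt (kern m) (kern1 m y) y := by
  refine HasDerivAt.const_mul (1 / (m : ℝ)) (HasDerivAt.fun_sum fun l _ => ?_)
  have h := ((hasDerivAt_id y).const_mul (angFreq m l)).cos
  refine h.congr_deriv ?_
  simp only [id]; ring

theorem hasDerivAt_kern1 (m : ℕ) (y : ℝ) : HasDerivAt (kern1 m) (kern2 m y) y := by
  refine HasDerivAt.const_mul (1 / (m : ℝ)) (HasDerivAt.fun_sum fun l _ => ?_)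
  have h := ((((hasDerivAt_id y).const_mul (angFreq m l)).sin).const_mul (angFreq m l)).fun_neg
  refine h.congr_deriv ?_
  simp only [id]; ring

theorem kern_neg (m : ℕ) (y : ℝ) : kern m (-y) = kern m y := by simp [kern]

theorem kern1_neg (m : ℕ) (y : ℝ) : kern1 m (-y) = -kern1 m y := by simp [kern1]

theorem kern_zero {m : ℕ} (hm : 0 < m) : kern m 0 = 1 := by
  have : (m : ℝ) ≠ 0 := by positivity
  simp [kern, this]

theorem kern_abs (m : ℕ) (y : ℝ) : kern m |y| = kern m y := by
  rcases abs_choice y with h | h <;> simp [h, kern_neg]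

/-- The closed form of the kernel: multiplied by `2 sin (y / m)` the sum of cosines telescopes. -/
theorem mul_sin_mul_kern {m : ℕ} (hm : 0 < m) (y : ℝ) :
    m * sin (y / m) * kern m y = sin y := by
  have hm' : (m : ℝ) ≠ 0 := by positivity
  have key : ∀ l : Fin m, 2 * sin (y / m) * cos (angFreq m l * y)
      = sin ((2 * ((l : ℕ) + 1 : ℕ) - m) / m * y) - sin ((2 * ((l : ℕ) : ℕ) - m) / m * y) := by
    intro l
    rw [sin_sub_sin]
    congr 2
    · congr 1
      push_cast; field_simp; ring
    · unfold angFreq freqIndex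
      push_cast; field_simp; ring
  have hsum : 2 * sin (y / m) * ∑ l : Fin m, cos (angFreq m l * y) = 2 * sin y := by
    rw [Finset.mul_sum, Finset.sum_congr rfl fun l _ => key l,
      Fin.sum_univ_eq_sum_range (fun l : ℕ =>
        sin ((2 * ((l + 1 : ℕ) : ℝ) - m) / m * y) - sin ((2 * (l : ℝ) - m) / m * y)) m,
      Finset.sum_range_sub (fun l : ℕ => sin ((2 * (l : ℝ) - m) / m * y))]
    have h1 : (2 * (m : ℝ) - m) / m * y = y := by field_simp; ring
    have h2 : (2 * ((0 : ℕ) : ℝ) - m) / m * y = -y := by field_simp; simp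
    rw [h1, h2, sin_neg]; ring
  unfold kern
  calc _ = (m * (1 / m)) * (2 * sin (y / m) * ∑ l : Fin m, cos (angFreq m l * y)) / 2 := by ring
    _ = sin y := by rw [hsum]; field_simp

/-- The derivative of the closed form `mul_sin_mul_kern`. -/
theorem cos_mul_kern_add {m : ℕ} (hm : 0 < m) (y : ℝ) :
    cos (y / m) * kern m y + m * sin (y / m) * kern1 m y = cos y := by
  have hm' : (m : ℝ) ≠ 0 := by positivity
  have h1 : HasDerivAt (fun y : ℝ => m * sin (y / m) * kern m y)
      (m * (cos (y / m) * (1 / m)) * kern m y + m * sin (y / m) * kern1 m y) y :=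
    ((((hasDerivAt_id y).div_const (m : ℝ)).sin).const_mul (m : ℝ)).mul (hasDerivAt_kern m y)
  have h2 : (fun y : ℝ => m * sin (y / m) * kern m y) = sin :=
    funext fun y => mul_sin_mul_kern hm y
  rw [h2] at h1
  have := h1.unique (hasDerivAt_sin y)
  rw [← this]; field_simp

theorem abs_angFreq_le {m : ℕ} (l : Fin m) : |angFreq m l| ≤ 1 := by
  have hm : 0 < m := l.pos
  have hm' : (0 : ℝ) < m := by positivity
  have h1 : ((l : ℕ) : ℝ) + 1 ≤ m := by exact_mod_cast l.isLt
  have h0 : (0 : ℝ) ≤ ((l : ℕ) : ℝ) := by positivity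
  unfold angFreq freqIndex
  rw [abs_le, le_div_iff₀ hm', div_le_iff₀ hm']
  constructor <;> linarith

theorem sum_range_sub_sq (n : ℕ) (c : ℝ) : ∑ l ∈ Finset.range n, ((l : ℝ) - c) ^ 2
    = n * (n - 1) * (2 * n - 1) / 6 - c * n * (n - 1) + n * c ^ 2 := by
  induction n with
  | zero => simp
  | succ k ih => rw [Finset.sum_range_succ, ih]; push_cast; ring

/-- The second moment `(1 - 1 / m²) / 3` of the scaled frequencies. -/
theorem angFreq_moment {m : ℕ} (hm : 0 < m) :
    (1 / m) * ∑ l : Fin m, angFreq m l ^ 2 = (1 - 1 / (m : ℝ) ^ 2) / 3 := by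
  have hm' : (m : ℝ) ≠ 0 := by positivity
  have h : ∑ l : Fin m, angFreq m l ^ 2
      = 4 / (m : ℝ) ^ 2 * ∑ l ∈ Finset.range m, ((l : ℝ) - ((m : ℝ) - 1) / 2) ^ 2 := by
    rw [Finset.mul_sum, ← Fin.sum_univ_eq_sum_range
      (fun l : ℕ => 4 / (m : ℝ) ^ 2 * ((l : ℝ) - ((m : ℝ) - 1) / 2) ^ 2)]
    refine Finset.sum_congr rfl fun l _ => ?_
    unfold angFreq freqIndex
    field_simp; ring
  rw [h, sum_range_sub_sq]
  field_simp; ring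

theorem angFreq_moment_le {m : ℕ} (hm : 0 < m) :
    (1 / m) * ∑ l : Fin m, angFreq m l ^ 2 ≤ 1 / 3 := by
  rw [angFreq_moment hm]
  have : 0 ≤ 1 / (m : ℝ) ^ 2 := by positivity
  linarith

theorem le_angFreq_moment {m : ℕ} (hm : 100 ≤ m) :
    0.33329 ≤ (1 / m) * ∑ l : Fin m, angFreq m l ^ 2 := by
  rw [angFreq_moment (by omega)]
  have h : (100 : ℝ) ≤ m := by exact_mod_cast hm
  have : 1 / (m : ℝ) ^ 2 ≤ 1 / 100 ^ 2 := by gcongr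
  norm_num at *
  linarith

theorem angFreq_fourth_moment_le {m : ℕ} (hm : 0 < m) :
    (1 / m) * ∑ l : Fin m, angFreq m l ^ 4 ≤ 1 / 3 := by
  refine le_trans ?_ (angFreq_moment_le hm)
  gcongr 1 / (m : ℝ) * ∑ l : Fin m, ?_ with l
  have := (sq_le_one_iff_abs_le_one _).2 (abs_angFreq_le l)
  nlinarith [sq_nonneg (angFreq m l)]

theorem abs_kern_le_one {m : ℕ} (hm : 0 < m) (y : ℝ) : |kern m y| ≤ 1 := by
  have hm' : (m : ℝ) ≠ 0 := by positivity
  unfold kern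
  rw [abs_mul, abs_of_nonneg (by positivity : (0 : ℝ) ≤ 1 / m)]
  have h : |∑ l : Fin m, cos (angFreq m l * y)| ≤ ∑ l : Fin m, (1 : ℝ) :=
    (Finset.abs_sum_le_sum_abs _ _).trans (Finset.sum_le_sum fun l _ => abs_cos_le_one _)
  simp only [Finset.sum_const, Finset.card_univ, Fintype.card_fin, nsmul_eq_mul, mul_one] at h
  calc 1 / (m : ℝ) * _ ≤ 1 / m * m := by gcongr
    _ = 1 := by field_simp

theorem abs_kern1_le {m : ℕ} (hm : 0 < m) (y : ℝ) : |kern1 m y| ≤ |y| / 3 := by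
  unfold kern1
  rw [abs_mul, abs_of_nonneg (by positivity : (0 : ℝ) ≤ 1 / m)]
  have h : |∑ l : Fin m, -(angFreq m l * sin (angFreq m l * y))|
      ≤ ∑ l : Fin m, angFreq m l ^ 2 * |y| := by
    refine (Finset.abs_sum_le_sum_abs _ _).trans (Finset.sum_le_sum fun l _ => ?_)
    have h2 : |sin (angFreq m l * y)| ≤ |angFreq m l * y| := abs_sin_le_abs
    rw [abs_neg, abs_mul, ← sq_abs (angFreq m l)]
    rw [abs_mul] at h2
    nlinarith [abs_nonneg (angFreq m l)]
  rw [← Finset.sum_mul] at h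
  calc 1 / (m : ℝ) * _ ≤ 1 / m * ((∑ l : Fin m, angFreq m l ^ 2) * |y|) := by gcongr
    _ = (1 / m * ∑ l : Fin m, angFreq m l ^ 2) * |y| := by ring
    _ ≤ 1 / 3 * |y| := by gcongr; exact angFreq_moment_le hm
    _ = |y| / 3 := by ring

theorem one_sub_le_kern {m : ℕ} (hm : 0 < m) (y : ℝ) : 1 - y ^ 2 / 6 ≤ kern m y := by
  have hm' : (m : ℝ) ≠ 0 := by positivity
  have h : ∑ l : Fin m, (1 - angFreq m l ^ 2 * (y ^ 2 / 2)) ≤ ∑ l : Fin m, cos (angFreq m l * y) :=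
    Finset.sum_le_sum fun l _ => by
      have := one_sub_sq_div_two_le_cos (x := angFreq m l * y)
      linarith [mul_pow (angFreq m l) y 2]
  rw [Finset.sum_sub_distrib, ← Finset.sum_mul] at h
  simp only [Finset.sum_const, Finset.card_univ, Fintype.card_fin, nsmul_eq_mul, mul_one] at h
  have h2 := angFreq_moment_le hm
  calc 1 - y ^ 2 / 6 ≤ 1 - (1 / m * ∑ l : Fin m, angFreq m l ^ 2) * (y ^ 2 / 2) := by
        nlinarith [sq_nonneg y]
    _ = 1 / m * (m - (∑ l : Fin m, angFreq m l ^ 2) * (y ^ 2 / 2)) := by field_simp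
    _ ≤ kern m y := by unfold kern; gcongr

theorem kern_le_taylor {m : ℕ} (hm : 100 ≤ m) (y : ℝ) :
    kern m y ≤ 1 - 0.16664 * y ^ 2 + y ^ 4 / 72 := by
  have hm0 : 0 < m := by omega
  have hm' : (m : ℝ) ≠ 0 := by positivity
  have h : ∑ l : Fin m, cos (angFreq m l * y) ≤
      ∑ l : Fin m, (1 - angFreq m l ^ 2 * (y ^ 2 / 2) + angFreq m l ^ 4 * (y ^ 4 / 24)) :=
    Finset.sum_le_sum fun l _ => by
      have := cos_le_taylor_four (abs_nonneg (angFreq m l * y))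
      rw [cos_abs, sq_abs, (by norm_num : 4 = 2 * 2), pow_mul, sq_abs] at this
      linarith [mul_pow (angFreq m l) y 2, mul_pow (angFreq m l) y 4,
        pow_mul (angFreq m l * y) 2 2]
  rw [Finset.sum_add_distrib, Finset.sum_sub_distrib, ← Finset.sum_mul, ← Finset.sum_mul] at h
  simp only [Finset.sum_const, Finset.card_univ, Fintype.card_fin, nsmul_eq_mul, mul_one] at h
  have h2 := le_angFreq_moment hm
  have h4 := angFreq_fourth_moment_le hm0
  calc kern m y ≤ 1 / m * (m - (∑ l : Fin m, angFreq m l ^ 2) * (y ^ 2 / 2)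
        + (∑ l : Fin m, angFreq m l ^ 4) * (y ^ 4 / 24)) := by unfold kern; gcongr
    _ = 1 - (1 / m * ∑ l : Fin m, angFreq m l ^ 2) * (y ^ 2 / 2)
        + (1 / m * ∑ l : Fin m, angFreq m l ^ 4) * (y ^ 4 / 24) := by field_simp
    _ ≤ 1 - (0.33329) * (y ^ 2 / 2) + 1 / 3 * (y ^ 4 / 24) := by gcongr
    _ ≤ _ := by nlinarith [sq_nonneg y]

theorem kern2_le {m : ℕ} (hm : 100 ≤ m) (y : ℝ) : kern2 m y ≤ -(0.33329 - y ^ 2 / 6) := by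
  have hm0 : 0 < m := by omega
  have h : ∑ l : Fin m, -(angFreq m l ^ 2 * cos (angFreq m l * y)) ≤
      ∑ l : Fin m, (angFreq m l ^ 4 * (y ^ 2 / 2) - angFreq m l ^ 2) :=
    Finset.sum_le_sum fun l _ => by
      have := one_sub_sq_div_two_le_cos (x := angFreq m l * y)
      nlinarith [mul_le_mul_of_nonneg_left this (sq_nonneg (angFreq m l))]
  rw [Finset.sum_sub_distrib, ← Finset.sum_mul] at h
  have h2 := le_angFreq_moment hm
  have h4 := angFreq_fourth_moment_le hm0
  calc kern2 m y ≤ 1 / m * ((∑ l : Fin m, angFreq m l ^ 4) * (y ^ 2 / 2)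
        - ∑ l : Fin m, angFreq m l ^ 2) := by unfold kern2; gcongr
    _ = (1 / m * ∑ l : Fin m, angFreq m l ^ 4) * (y ^ 2 / 2)
        - 1 / m * ∑ l : Fin m, angFreq m l ^ 2 := by ring
    _ ≤ 1 / 3 * (y ^ 2 / 2) - (0.33329) := by gcongr
    _ ≤ _ := by linarith

theorem abs_kern2_le {m : ℕ} (hm : 0 < m) (y : ℝ) : |kern2 m y| ≤ 1 / 3 := by
  unfold kern2
  rw [abs_mul, abs_of_nonneg (by positivity : (0 : ℝ) ≤ 1 / m)]
  refine le_trans ?_ (angFreq_moment_le hm)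
  gcongr
  refine (Finset.abs_sum_le_sum_abs _ _).trans (Finset.sum_le_sum fun l _ => ?_)
  rw [abs_neg, abs_mul, abs_of_nonneg (sq_nonneg (angFreq m l))]
  exact mul_le_of_le_one_right (sq_nonneg _) (abs_cos_le_one _)

/-- Decay of the kernel, in terms of `m² sin²(y / m)`. -/
theorem kern_sq_mul_le {m : ℕ} (hm : 0 < m) (y : ℝ) :
    (m * sin (y / m)) ^ 2 * kern m y ^ 2 ≤ 1 := by
  rw [← mul_pow, mul_sin_mul_kern hm]
  exact sin_sq_le_one y

theorem kern1_sq_mul_le {m : ℕ} (hm : 0 < m) (y : ℝ) :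
    ((m * sin (y / m)) ^ 2) ^ 2 * kern1 m y ^ 2 ≤ (m * sin (y / m)) ^ 2 + 1 := by
  have h1 := mul_sin_mul_kern hm y
  have h2 := cos_mul_kern_add hm y
  set p := (m : ℝ) * sin (y / m)
  have h3 : p ^ 2 * kern1 m y = p * cos y - cos (y / m) * sin y := by
    rw [← h2, ← h1]; ring
  have h4 := sin_sq_add_cos_sq y
  have h5 : cos (y / m) ^ 2 ≤ 1 := cos_sq_le_one _
  calc (p ^ 2) ^ 2 * kern1 m y ^ 2 = (p * cos y - cos (y / m) * sin y) ^ 2 := by rw [← h3]; ring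
    _ ≤ (p ^ 2 + cos (y / m) ^ 2) * (sin y ^ 2 + cos y ^ 2) := by
        nlinarith [sq_nonneg (p * sin y + cos (y / m) * cos y)]
    _ ≤ p ^ 2 + 1 := by rw [h4]; linarith

/-- `kern1² ≤ 0.186` where `|y| ≤ 1.75`: by Cauchy–Schwarz the square of
`∑ κ sin (κ y) / m` is at most the second moment times `(1 - kern (2 y)) / 2`. -/
theorem kern1_sq_le {m : ℕ} (hm : 100 ≤ m) {y : ℝ} (hy : |y| ≤ 1.75) :
    kern1 m y ^ 2 ≤ 0.186 := by
  have hm0 : 0 < m := by omega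
  have hmR : (100 : ℝ) ≤ m := by exact_mod_cast hm
  have hm' : (m : ℝ) ≠ 0 := by positivity
  have hcs : kern1 m y ^ 2 ≤ 1 / 3 * ((1 - kern m (2 * y)) / 2) := by
    have h1 : (∑ l : Fin m, -(angFreq m l * sin (angFreq m l * y))) ^ 2 ≤
        (∑ l : Fin m, angFreq m l ^ 2) * ∑ l : Fin m, sin (angFreq m l * y) ^ 2 := by
      rw [Finset.sum_neg_distrib, neg_sq]
      exact Finset.sum_mul_sq_le_sq_mul_sq _ _ _
    have h2 : (1 / m) * ∑ l : Fin m, sin (angFreq m l * y) ^ 2 = (1 - kern m (2 * y)) / 2 := by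
      have : ∀ l : Fin m, sin (angFreq m l * y) ^ 2 = 1 / 2 - cos (angFreq m l * (2 * y)) / 2 := by
        intro l
        rw [sin_sq_eq_half_sub]; ring_nf
      rw [Finset.sum_congr rfl fun l _ => this l, Finset.sum_sub_distrib, ← Finset.sum_div,
        ← Finset.sum_div]
      simp only [Finset.sum_const, Finset.card_univ, Fintype.card_fin, nsmul_eq_mul, kern]
      generalize ∑ l : Fin m, cos (angFreq m l * (2 * y)) = c
      field_simp
    have h3 : 0 ≤ (1 / (m : ℝ)) * ∑ l : Fin m, sin (angFreq m l * y) ^ 2 := by positivity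
    calc kern1 m y ^ 2
        = (1 / m) ^ 2 * (∑ l : Fin m, -(angFreq m l * sin (angFreq m l * y))) ^ 2 := by
          unfold kern1; ring
      _ ≤ (1 / m) ^ 2 *
          ((∑ l : Fin m, angFreq m l ^ 2) * ∑ l : Fin m, sin (angFreq m l * y) ^ 2) := by
          gcongr
      _ = ((1 / m) * ∑ l : Fin m, angFreq m l ^ 2) *
          ((1 / m) * ∑ l : Fin m, sin (angFreq m l * y) ^ 2) := by ring
      _ ≤ 1 / 3 * ((1 / m) * ∑ l : Fin m, sin (angFreq m l * y) ^ 2) := by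
          gcongr; exact angFreq_moment_le hm0
      _ = _ := by rw [h2]
  have hk : -0.116 ≤ kern m (2 * y) := by
    rw [← kern_abs]
    have ht : |2 * y| ≤ 3.5 := by rw [abs_mul, abs_two]; linarith
    have ht0 : 0 ≤ |2 * y| := abs_nonneg _
    set t := |2 * y|
    by_cases h1 : t ≤ 2
    · have := one_sub_le_kern hm0 t
      nlinarith
    have h2 := mul_sin_mul_kern hm0 t
    have hz0 : 0 < t / m := by push Not at h1; positivity
    have hz1 : t / m ≤ 0.035 := by
      rw [div_le_iff₀ (by positivity)]; nlinarith
    have hs1 := sin_gt_sub_cube hz0 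
    have hp : 1.99 < m * sin (t / m) := by
      have : t = m * (t / m) := by field_simp
      have h3 : 0.9996 * (t / m) ≤ sin (t / m) := by nlinarith [mul_pos hz0 hz0]
      nlinarith
    have hsin : -0.359 ≤ sin t := by
      have := pi_gt_d4
      have e : sin t = - sin (t - π) := by rw [sin_sub_pi]; ring
      by_cases h4 : t ≤ π
      · linarith [sin_nonneg_of_nonneg_of_le_pi ht0 h4]
      · rw [e]; linarith [sin_le (by linarith : 0 ≤ t - π)]
    by_cases h5 : t ≤ π
    · have := sin_nonneg_of_nonneg_of_le_pi ht0 h5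
      by_contra h6
      push Not at h6
      nlinarith
    · have hp2 : 3.1 < m * sin (t / m) := by
        have : t = m * (t / m) := by field_simp
        have h3 : 0.9996 * (t / m) ≤ sin (t / m) := by nlinarith [mul_pos hz0 hz0]
        have := pi_gt_d4
        nlinarith
      by_contra h6
      push Not at h6
      nlinarith
  linarith

/-- The values at `w = y²` of the Taylor polynomials that occur in `kern_slope`. -/
theorem kern_slope_poly {w : ℝ} (hw0 : 0 ≤ w) :
    (w ≤ 3.0625 → 0.56 ≤ 1 - w / 6 + w ^ 2 / 120 - w ^ 3 / 5040) ∧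
    (w ≤ 3.0625 → 0.24 ≤ 1 / 3 - w / 30 + w ^ 2 / 840 - w ^ 3 / 40320 - 1 / 20000) ∧
    (w ≤ 0.16 → 0.325 ≤ 1 / 3 - w / 30 + w ^ 2 / 840 - w ^ 3 / 40320 - 1 / 20000) := by
  refine ⟨fun hw1 => ?_, fun hw1 => ?_, fun hw1 => ?_⟩ <;>
  nlinarith [mul_nonneg hw0 (sub_nonneg.2 hw1), mul_nonneg hw0 (mul_nonneg hw0 (sub_nonneg.2 hw1))]

/-- `kern1 y / y` is at most `-0.24` on `(0, 1.75]` and at most `-0.325` on `(0, 0.4]`, while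
`kern ≥ 0.56` on the larger interval: there `kern y` is `sin y / y` up to an error of order
`1 / m²`. -/
theorem kern_slope {m : ℕ} (hm : 100 ≤ m) {y : ℝ} (h0 : 0 < y) (hy : y ≤ 1.75) :
    0.56 ≤ kern m y ∧ 0.24 * y ≤ -kern1 m y ∧ (y ≤ 0.4 → 0.325 * y ≤ -kern1 m y) := by
  have hm0 : 0 < m := by omega
  have hmR : (100 : ℝ) ≤ m := by exact_mod_cast hm
  have hm' : (m : ℝ) ≠ 0 := by positivity
  have h1 := mul_sin_mul_kern hm0 y
  have h2 := cos_mul_kern_add hm0 y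
  have hk1 : kern m y ≤ 1 := (abs_le.1 (abs_kern_le_one hm0 y)).2
  have hz0 : 0 < y / m := by positivity
  have hz1 : y / m ≤ y / 100 := by gcongr
  have hc := one_sub_sq_div_two_le_cos (x := y / m)
  have hMy : m * sin (y / m) ≤ y := by
    calc m * sin (y / m) ≤ m * (y / m) := by gcongr; exact sin_le hz0.le
      _ = y := by field_simp
  have hM0 : 0 < m * sin (y / m) := by
    have := sin_pos_of_pos_of_lt_pi hz0 (by linarith [pi_gt_three])
    positivity
  set M := (m : ℝ) * sin (y / m)
  have hs := taylor_seven_le_sin h0.le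
  have hc8 := cos_le_taylor_eight h0.le
  have hw0 : 0 < y ^ 2 := by positivity
  have hw : y ^ 2 ≤ 3.0625 := by nlinarith
  have hs0 : 0 < sin y := sin_pos_of_pos_of_lt_pi h0 (by linarith [pi_gt_three])
  have hk0 : 0 < kern m y := by
    by_contra h; push Not at h; nlinarith
  have hky : sin y ≤ y * kern m y := by nlinarith
  have hz2 : (y / m) ^ 2 / 2 ≤ y ^ 2 / 20000 := by nlinarith
  -- the numerator of `-kern1 = (cos (y / m) * kern - cos y) / M`, multiplied by `y`
  have hN : y ^ 3 * (1 / 3 - y ^ 2 / 30 + (y ^ 2) ^ 2 / 840 - (y ^ 2) ^ 3 / 40320 - 1 / 20000)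
      ≤ y * (cos (y / m) * kern m y - cos y) := by
    have e1 : kern m y - y ^ 2 / 20000 ≤ cos (y / m) * kern m y := by nlinarith
    have e2 : y * (kern m y - y ^ 2 / 20000 - cos y) ≤ y * (cos (y / m) * kern m y - cos y) := by
      gcongr
    have e3 := mul_le_mul_of_nonneg_left hc8 h0.le
    refine le_trans ?_ e2
    calc _ = (y - y ^ 3 / 6 + y ^ 5 / 120 - y ^ 7 / 5040) - y * (1 - y ^ 2 / 2 + y ^ 4 / 24
          - y ^ 6 / 720 + y ^ 8 / 40320) - y ^ 3 / 20000 := by ring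
      _ ≤ y * kern m y - y * cos y - y ^ 3 / 20000 := by linarith
      _ = _ := by ring
  have hNM : cos (y / m) * kern m y - cos y = M * (-kern1 m y) := by linarith
  have key : ∀ c : ℝ, 0 ≤ c →
      c ≤ 1 / 3 - y ^ 2 / 30 + (y ^ 2) ^ 2 / 840 - (y ^ 2) ^ 3 / 40320 - 1 / 20000 →
      c * y ≤ -kern1 m y := by
    intro c hc0 hcle
    have e1 : y ^ 3 * c ≤ y * (M * (-kern1 m y)) := by
      rw [← hNM]; exact (mul_le_mul_of_nonneg_left hcle (by positivity)).trans hN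
    have e2 : 0 ≤ -kern1 m y := by
      by_contra h
      push Not at h
      have : y * (M * (-kern1 m y)) < 0 := by
        have := mul_pos h0 hM0
        nlinarith
      have : 0 ≤ y ^ 3 * c := by positivity
      linarith
    have e3 : y ^ 2 * (c * y) ≤ y ^ 2 * (-kern1 m y) := by
      have := mul_le_mul_of_nonneg_left (mul_le_mul_of_nonneg_right hMy e2) h0.le
      nlinarith
    exact le_of_mul_le_mul_left e3 hw0
  refine ⟨?_, key _ (by norm_num) ((kern_slope_poly hw0.le).2.1 hw),
    fun h => key _ (by norm_num) ((kern_slope_poly hw0.le).2.2 (by nlinarith))⟩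
  have e1 := (kern_slope_poly hw0.le).1 hw
  have e2 : y * 0.56 ≤ y * kern m y := by nlinarith
  exact le_of_mul_le_mul_left e2 h0

/-! ### Separated points on the torus -/

theorem coe_rep (t : Torus) : ((rep t : ℝ) : Torus) = t := AddCircle.coe_equivIoc

theorem abs_rep (t : Torus) : |rep t| = ‖t‖ := by
  have h := (AddCircle.equivIoc (2 * π) (-π) t).2
  have h1 : -π < rep t := h.1
  have h2 : rep t ≤ -π + 2 * π := h.2
  conv_rhs => rw [← coe_rep t]
  refine ((AddCircle.norm_coe_eq_abs_iff (2 * π) two_pi_pos.ne').2 ?_).symm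
  rw [abs_of_pos two_pi_pos, abs_le]
  constructor <;> linarith

theorem norm_torus_le_pi (t : Torus) : ‖t‖ ≤ π := by
  have := AddCircle.norm_le_half_period (2 * π) two_pi_pos.ne' (x := t)
  rwa [abs_of_pos two_pi_pos, mul_div_cancel_left₀ _ two_ne_zero] at this

theorem norm_coe_torus_le (u : ℝ) : ‖(u : Torus)‖ ≤ |u| := by
  by_cases h : |u| ≤ π
  · refine ((AddCircle.norm_coe_eq_abs_iff (2 * π) two_pi_pos.ne').2 ?_).le
    rw [abs_of_pos two_pi_pos]; linarith
  · push Not at h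
    exact (norm_torus_le_pi _).trans h.le

theorem norm_coe_torus {u : ℝ} (h : |u| ≤ π) : ‖(u : Torus)‖ = |u| := by
  refine (AddCircle.norm_coe_eq_abs_iff (2 * π) two_pi_pos.ne').2 ?_
  rw [abs_of_pos two_pi_pos]; linarith

/-- The point of the torus at scaled displacement `y` from `p`. -/
noncomputable def scaledPoint (m : ℕ) (p : Torus) (y : ℝ) : Torus :=
  ((rep p + 2 * y / m : ℝ) : Torus)

theorem rep_coe {u : ℝ} (h1 : -π < u) (h2 : u ≤ π) : rep (u : Torus) = u := by
  have h := (AddCircle.equivIoc (2 * π) (-π) (u : Torus)).2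
  have e : ((rep (u : Torus) - u : ℝ) : Torus) = 0 := by
    rw [AddCircle.coe_sub, coe_rep, sub_self]
  have h3 : -π < rep (u : Torus) := h.1
  have h4 : rep (u : Torus) ≤ -π + 2 * π := h.2
  obtain ⟨n, hn⟩ := (AddCircle.coe_eq_zero_iff _).1 e
  rw [zsmul_eq_mul] at hn
  have hπ := pi_pos
  have h5 : (n : ℝ) < 1 := by
    by_contra h; push Not at h; nlinarith
  have h6 : -1 < (n : ℝ) := by
    by_contra h; push Not at h; nlinarith
  have h7 : n = 0 := by
    have h5' : n < 1 := by exact_mod_cast h5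
    have h6' : -1 < n := by exact_mod_cast h6
    omega
  rw [h7, Int.cast_zero, zero_mul] at hn
  linarith

theorem scaledPoint_sub (m : ℕ) (p : Torus) (a b : ℝ) :
    scaledPoint m p b - scaledPoint m p a = ((2 * (b - a) / m : ℝ) : Torus) := by
  rw [scaledPoint, scaledPoint, ← AddCircle.coe_sub]
  congr 1; ring

theorem dist_scaledPoint_le (m : ℕ) (p : Torus) (a b : ℝ) :
    dist (scaledPoint m p b) (scaledPoint m p a) ≤ 2 * |b - a| / m := by
  rw [dist_eq_norm, scaledPoint_sub]
  refine (norm_coe_torus_le _).trans (le_of_eq ?_)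
  rw [abs_div, abs_mul, abs_two, Nat.abs_cast]

theorem scaledPoint_zero (m : ℕ) (p : Torus) : scaledPoint m p 0 = p := by
  rw [scaledPoint, mul_zero, zero_div, add_zero, coe_rep]

theorem dist_scaledPoint_eq {m : ℕ} (p : Torus) {y : ℝ} (h : 2 * |y| / m ≤ π) :
    dist (scaledPoint m p y) p = 2 * |y| / m := by
  have e : |2 * y / m| = 2 * |y| / m := by rw [abs_div, abs_mul, abs_two, Nat.abs_cast]
  conv_lhs => rw [← scaledPoint_zero m p, scaledPoint_zero m p]
  have h1 := scaledPoint_sub m p 0 y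
  rw [scaledPoint_zero, sub_zero] at h1
  rw [dist_eq_norm, h1, norm_coe_torus (by rwa [e]), e]

theorem exists_scaledPoint {m : ℕ} (hm : 0 < m) (p t : Torus) :
    ∃ y : ℝ, t = scaledPoint m p y ∧ |y| = m * dist t p / 2 := by
  have hm' : (0 : ℝ) < m := by positivity
  refine ⟨m * rep (t - p) / 2, ?_, ?_⟩
  · rw [scaledPoint, show 2 * (m * rep (t - p) / 2) / m = rep (t - p) by field_simp,
      AddCircle.coe_add, coe_rep, coe_rep, add_sub_cancel]
  · rw [abs_div, abs_mul, abs_rep, abs_of_pos hm', abs_two, dist_eq_norm]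

/-- Points at mutual distance at least `D` lie on either side of `c` at distances that dominate
`a, a + D, a + 2 D, …`. -/
theorem sum_le_of_separated {ι : Type*} (K : Finset ι) (x : ι → Torus) (c : Torus) {D a : ℝ}
    (hD : 0 < D) (hsep : ∀ k ∈ K, ∀ l ∈ K, k ≠ l → D ≤ dist (x k) (x l))
    (hK : ∀ k ∈ K, a ≤ dist c (x k)) (N : ℕ) (hN : π < a + N * D) (g : ℝ → ℝ)
    (hg : ∀ d e, a ≤ d → d ≤ e → g e ≤ g d) (hg0 : ∀ d, a ≤ d → 0 ≤ g d) :
    ∑ k ∈ K, g (dist c (x k)) ≤ 2 * ∑ n ∈ Finset.range N, g (a + n * D) := by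
  classical
  have hdist : ∀ k, dist c (x k) = |rep (x k - c)| := fun k => by
    rw [abs_rep, dist_comm, dist_eq_norm]
  let f : ι → Bool × ℕ := fun k => (decide (0 ≤ rep (x k - c)), ⌊(dist c (x k) - a) / D⌋₊)
  have hfl : ∀ k ∈ K, a + (f k).2 * D ≤ dist c (x k) ∧ dist c (x k) < a + (f k).2 * D + D := by
    intro k hk
    have h0 : 0 ≤ (dist c (x k) - a) / D := div_nonneg (by linarith [hK k hk]) hD.le
    have h1 := Nat.floor_le h0
    have h2 := Nat.lt_floor_add_one ((dist c (x k) - a) / D)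
    rw [le_div_iff₀ hD] at h1
    rw [div_lt_iff₀ hD] at h2
    simp only [f]
    constructor <;> linarith
  have hinj : Set.InjOn f K := by
    intro k hk l hl hkl
    by_contra hne
    have h1 := hfl k hk
    have h2 := hfl l hl
    rw [hkl] at h1
    have h3 := hsep k hk l hl hne
    have h4 : dist (x k) (x l) ≤ |rep (x k - c) - rep (x l - c)| := by
      have : x k - x l = ((rep (x k - c) - rep (x l - c) : ℝ) : Torus) := by
        rw [AddCircle.coe_sub, coe_rep, coe_rep]; abel
      rw [dist_eq_norm, this]
      exact norm_coe_torus_le _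
    have h5 : (0 ≤ rep (x k - c)) ↔ (0 ≤ rep (x l - c)) := by
      have := congrArg Prod.fst hkl
      simpa [f] using this
    rw [hdist k] at h1
    rw [hdist l] at h2
    have h6 : |rep (x k - c) - rep (x l - c)| < D := by
      by_cases hs : 0 ≤ rep (x k - c)
      · rw [abs_of_nonneg hs] at h1
        rw [abs_of_nonneg (h5.1 hs)] at h2
        rw [abs_lt]; constructor <;> linarith [h1.1, h1.2, h2.1, h2.2]
      · have hs' : ¬ 0 ≤ rep (x l - c) := fun h => hs (h5.2 h)
        push Not at hs hs'
        rw [abs_of_neg hs] at h1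
        rw [abs_of_neg hs'] at h2
        rw [abs_lt]; constructor <;> linarith [h1.1, h1.2, h2.1, h2.2]
    linarith
  have hsub : K.image f ⊆ (Finset.univ : Finset Bool) ×ˢ Finset.range N := by
    intro p hp
    obtain ⟨k, hk, rfl⟩ := Finset.mem_image.1 hp
    rw [Finset.mem_product, Finset.mem_range]
    refine ⟨Finset.mem_univ _, ?_⟩
    have h1 := (hfl k hk).1
    have h2 : dist c (x k) ≤ π := by rw [dist_eq_norm]; exact norm_torus_le_pi _
    have h3 : ((f k).2 : ℝ) * D < N * D := by linarith
    exact_mod_cast lt_of_mul_lt_mul_right h3 hD.le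
  have hge : ∀ n : ℕ, a ≤ a + n * D := fun n => by
    have : 0 ≤ (n : ℝ) * D := by positivity
    linarith
  calc ∑ k ∈ K, g (dist c (x k)) ≤ ∑ k ∈ K, g (a + (f k).2 * D) :=
        Finset.sum_le_sum fun k hk => hg _ _ (hge _) (hfl k hk).1
    _ = ∑ p ∈ K.image f, g (a + p.2 * D) :=
        (Finset.sum_image (f := fun p : Bool × ℕ => g (a + p.2 * D)) hinj).symm
    _ ≤ ∑ p ∈ (Finset.univ : Finset Bool) ×ˢ Finset.range N, g (a + p.2 * D) :=
        Finset.sum_le_sum_of_subset_of_nonneg hsub fun p _ _ => hg0 _ (hge _)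
    _ = 2 * ∑ n ∈ Finset.range N, g (a + n * D) := by
        rw [Finset.sum_product]; simp [two_mul]

/-- Each term `1 / x²` is at most the telescoping difference
`(1 / c) (1 / (x - c / 2) - 1 / (x + c / 2))`. -/
theorem sum_inv_sq_le {A c : ℝ} (hA : 0 < A) (hc : 0 < c) (N : ℕ) :
    ∑ n ∈ Finset.range N, 1 / (A + c * n) ^ 2 ≤ 1 / A ^ 2 + 1 / (c * (A + c / 2)) := by
  have key : ∀ N : ℕ, ∑ n ∈ Finset.range (N + 1), 1 / (A + c * n) ^ 2
      ≤ 1 / A ^ 2 + 1 / c * (1 / (A + c / 2) - 1 / (A + c * N + c / 2)) := by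
    intro N
    induction N with
    | zero => simp
    | succ k ih =>
      rw [Finset.sum_range_succ]
      have hx : 0 < A + c * k + c / 2 := by positivity
      have hstep : 1 / (A + c * ((k + 1 : ℕ) : ℝ)) ^ 2
          ≤ 1 / c * (1 / (A + c * k + c / 2) - 1 / (A + c * ((k + 1 : ℕ) : ℝ) + c / 2)) := by
        have e1 : A + c * ((k + 1 : ℕ) : ℝ) = (A + c * k + c / 2) + c / 2 := by push_cast; ring
        rw [e1]
        set X := A + c * k + c / 2
        have : 1 / c * (1 / X - 1 / (X + c / 2 + c / 2)) = 1 / (X * (X + c)) := by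
          field_simp; ring
        rw [this]
        refine one_div_le_one_div_of_le (by positivity) ?_
        nlinarith [sq_nonneg c]
      have : 1 / c * (1 / (A + c / 2) - 1 / (A + c * ((k + 1 : ℕ) : ℝ) + c / 2)) =
        1 / c * (1 / (A + c / 2) - 1 / (A + c * k + c / 2)) +
        1 / c * (1 / (A + c * k + c / 2) - 1 / (A + c * ((k + 1 : ℕ) : ℝ) + c / 2)) := by ring
      linarith
  have hfin : 1 / (c * (A + c / 2)) = 1 / c * (1 / (A + c / 2)) := by field_simp
  cases N with
  | zero => simp; positivity
  | succ k =>
    refine (key k).trans ?_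
    rw [hfin]
    have : 0 ≤ 1 / c * (1 / (A + c * k + c / 2)) := by positivity
    linarith

/-- For points that are `8 π / m`-separated and at scaled distance more than `δ` from `c`. -/
theorem sum_decay_le {ι : Type*} (K : Finset ι) (x : ι → Torus) (c : Torus) {m : ℕ} (hm : 100 ≤ m)
    {a δ A : ℝ} (hsep : ∀ k ∈ K, ∀ l ∈ K, k ≠ l → 8 * π / m ≤ dist (x k) (x l))
    (hK : ∀ k ∈ K, a ≤ dist c (x k)) (ha : 0 ≤ a) (hA0 : 0 < A) (hA : m * a / 2 - δ = A) :
    ∑ k ∈ K, (1 / (m * dist c (x k) / 2 - δ) ^ 2 + 1 / (m : ℝ) ^ 2)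
      ≤ 2 * (1 / A ^ 2 + 1 / (4 * π * (A + 2 * π))) + 0.0027 := by
  have hm0 : 0 < m := by omega
  have hmR : (100 : ℝ) ≤ m := by exact_mod_cast hm
  have hm' : (m : ℝ) ≠ 0 := by positivity
  have hpi := pi_pos
  have hpos : ∀ d, a ≤ d → A ≤ m * d / 2 - δ := fun d hd => by
    rw [← hA]; gcongr
  -- at most `m / 8 + 1` points of the progression of step `8 π / m` fit into `[0, π]`
  have hN1 : (m : ℝ) / 8 < ((m / 8 + 1 : ℕ) : ℝ) := by
    have : m < 8 * (m / 8 + 1) := by omega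
    have : (m : ℝ) < 8 * ((m / 8 + 1 : ℕ) : ℝ) := by exact_mod_cast this
    linarith
  have hN2 : ((m / 8 + 1 : ℕ) : ℝ) ≤ m / 8 + 1 := by
    push_cast
    have : 8 * (m / 8) ≤ m := by omega
    have : 8 * ((m / 8 : ℕ) : ℝ) ≤ m := by exact_mod_cast this
    linarith
  refine (sum_le_of_separated K x c (D := 8 * π / m) (a := a) (by positivity) hsep hK (m / 8 + 1)
    ?_ (fun d => 1 / (m * d / 2 - δ) ^ 2 + 1 / (m : ℝ) ^ 2) ?_ ?_).trans ?_
  · have : π = m / 8 * (8 * π / m) := by field_simp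
    have h2 : (m : ℝ) / 8 * (8 * π / m) < ((m / 8 + 1 : ℕ) : ℝ) * (8 * π / m) := by gcongr
    linarith
  · intro d e hd hde
    have := hpos d hd
    have h2 : (0 : ℝ) < m * d / 2 - δ := by linarith
    gcongr
  · intro d hd
    positivity
  · rw [Finset.sum_add_distrib, Finset.sum_const, Finset.card_range, nsmul_eq_mul]
    have e1 : ∀ n : ℕ, (m : ℝ) * (a + n * (8 * π / m)) / 2 - δ = A + 4 * π * n := fun n => by
      rw [← hA]; field_simp; ring
    simp only [e1]
    have h1 := sum_inv_sq_le hA0 (by positivity : 0 < 4 * π) (m / 8 + 1)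
    have h2 : ((m / 8 + 1 : ℕ) : ℝ) * (1 / (m : ℝ) ^ 2) ≤ 0.00135 := by
      calc ((m / 8 + 1 : ℕ) : ℝ) * (1 / (m : ℝ) ^ 2) ≤ (m / 8 + 1) * (1 / (m : ℝ) ^ 2) := by gcongr
        _ ≤ 0.00135 := by
          rw [mul_one_div, div_le_iff₀ (by positivity)]; nlinarith
    rw [show 4 * π / 2 = 2 * π by ring] at h1
    linarith

/-- `1 / (m sin (v / 2))²`, which dominates `kern²`, depends only on the point of the torus
represented by `v`, and is at most `1 / y² + 1 / m²` at scaled distance `y`. -/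
theorem inv_mul_sin_sq_le {m : ℕ} (hm : 0 < m) {v : ℝ} (hv : (v : Torus) ≠ 0) :
    0 < (m * sin (v / 2)) ^ 2 ∧
    1 / (m * sin (v / 2)) ^ 2 ≤ 1 / (m * ‖(v : Torus)‖ / 2) ^ 2 + 1 / (m : ℝ) ^ 2 := by
  have hm' : (0 : ℝ) < m := by positivity
  set d := ‖(v : Torus)‖ with hd
  have hd0 : 0 < d := norm_pos_iff.2 hv
  have hdpi : d ≤ π := norm_torus_le_pi _
  have hsin : sin (v / 2) ^ 2 = sin (d / 2) ^ 2 := by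
    have hc : cos v = cos d := by
      rw [hd, AddCircle.norm_eq, cos_abs, cos_sub_int_mul_two_pi]
    rw [sin_sq_eq_half_sub, sin_sq_eq_half_sub, mul_div_cancel₀ _ two_ne_zero,
      mul_div_cancel₀ _ two_ne_zero, hc]
  have hs : 0 < sin (d / 2) := sin_pos_of_pos_of_lt_pi (by linarith) (by linarith)
  have h1 := inv_sin_sq_le (by linarith : 0 < d / 2) (by linarith)
  rw [mul_pow, hsin]
  refine ⟨by positivity, ?_⟩
  calc 1 / ((m : ℝ) ^ 2 * sin (d / 2) ^ 2) = 1 / (m : ℝ) ^ 2 * (1 / sin (d / 2) ^ 2) := by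
        rw [one_div_mul_one_div]
    _ ≤ 1 / (m : ℝ) ^ 2 * (1 / (d / 2) ^ 2 + 1) := by gcongr
    _ = _ := by field_simp

theorem kern_sq_le_decay {m : ℕ} (hm : 0 < m) {v : ℝ} (hv : (v : Torus) ≠ 0) :
    kern m (m * v / 2) ^ 2 ≤ 1 / (m * ‖(v : Torus)‖ / 2) ^ 2 + 1 / (m : ℝ) ^ 2 := by
  have hm' : (m : ℝ) ≠ 0 := by positivity
  obtain ⟨h1, h2⟩ := inv_mul_sin_sq_le hm hv
  have h3 := kern_sq_mul_le hm (m * v / 2)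
  rw [show (m : ℝ) * v / 2 / m = v / 2 by field_simp] at h3
  refine le_trans ?_ h2
  rw [le_div_iff₀ h1]; linarith

/-- Like `kern²`, `kern1²` is of the order of `1 / y²`. -/
theorem kern1_sq_le_decay {m : ℕ} (hm : 0 < m) {v : ℝ} (hv : (v : Torus) ≠ 0) {p : ℝ}
    (hp : 1 / (m * ‖(v : Torus)‖ / 2) ^ 2 + 1 / (m : ℝ) ^ 2 ≤ p) :
    kern1 m (m * v / 2) ^ 2 ≤ p * (1 + p) := by
  have hm' : (m : ℝ) ≠ 0 := by positivity
  obtain ⟨h1, h2⟩ := inv_mul_sin_sq_le hm hv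
  have h3 := kern1_sq_mul_le hm (m * v / 2)
  rw [show (m : ℝ) * v / 2 / m = v / 2 by field_simp] at h3
  set M := (m * sin (v / 2)) ^ 2
  have h4 : 1 / M ≤ p := h2.trans hp
  calc kern1 m (m * v / 2) ^ 2 ≤ 1 / M * (1 + 1 / M) := by
        rw [one_div_mul_eq_div, le_div_iff₀ h1]
        refine le_of_mul_le_mul_left ?_ h1
        have : M * (1 + 1 / M) = M + 1 := by field_simp
        nlinarith
    _ ≤ p * (1 + p) := by
        have h5 : 0 ≤ 1 / M := by positivity
        have h6 : 0 ≤ p := h5.trans h4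
        gcongr

/-! ### The steering curve -/

/-- The `n`-th derivative of the steering vector with respect to the scaled variable `m t / 2`. -/
noncomputable def wave (m n : ℕ) (v : ℝ) : EuclideanSpace ℂ (Fin m) :=
  WithLp.toLp 2 fun l => ((1 / √(m : ℝ) : ℝ) : ℂ) * (Complex.I * (angFreq m l : ℂ)) ^ n *
    Complex.exp (Complex.I * (angFreq m l : ℂ) * (v : ℂ))

theorem wave_apply (m n : ℕ) (v : ℝ) (l : Fin m) : wave m n v l =
    ((1 / √(m : ℝ) : ℝ) : ℂ) * (Complex.I * (angFreq m l : ℂ)) ^ n *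
    Complex.exp (Complex.I * (angFreq m l : ℂ) * (v : ℂ)) := rfl

theorem hasDerivAt_wave (m n : ℕ) (v : ℝ) : HasDerivAt (wave m n) (wave m (n + 1) v) v := by
  have h : HasDerivAt (fun v : ℝ => fun l => wave m n v l) (fun l => wave m (n + 1) v l) v := by
    rw [hasDerivAt_pi]
    intro l
    have h1 : HasDerivAt (fun v : ℝ => Complex.I * (angFreq m l : ℂ) * (v : ℂ))
        (Complex.I * (angFreq m l : ℂ) * 1) v :=
      (Complex.ofRealCLM.hasDerivAt (x := v)).const_mul (Complex.I * (angFreq m l : ℂ))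
    have h2 := h1.cexp.const_mul
      (((1 / √(m : ℝ) : ℝ) : ℂ) * (Complex.I * (angFreq m l : ℂ)) ^ n)
    refine h2.congr_deriv ?_
    rw [wave_apply]; ring
  exact ((PiLp.continuousLinearEquiv 2 ℝ
    (fun _ : Fin m => ℂ)).symm.toContinuousLinearMap.hasFDerivAt).comp_hasDerivAt v h

theorem angFreq_rev {m : ℕ} (l : Fin m) : angFreq m l.rev = -angFreq m l := by
  have h : ((l.rev : ℕ) : ℝ) = m - (((l : ℕ) : ℝ) + 1) := by
    rw [Fin.val_rev, Nat.cast_sub l.isLt]; push_cast; ring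
  unfold angFreq freqIndex
  rw [h]; ring

theorem sum_sin_angFreq (m : ℕ) (y : ℝ) : ∑ l : Fin m, sin (angFreq m l * y) = 0 := by
  have h : ∑ l : Fin m, sin (angFreq m l * y) = ∑ l : Fin m, -sin (angFreq m l * y) := by
    rw [← Equiv.sum_comp Fin.revPerm]
    refine Finset.sum_congr rfl fun l _ => ?_
    rw [Fin.revPerm_apply, angFreq_rev, neg_mul, sin_neg]
  rw [Finset.sum_neg_distrib] at h
  linarith

theorem inv_sqrt_mul_self (m : ℕ) :
    ((1 / √(m : ℝ) : ℝ) : ℂ) * ((1 / √(m : ℝ) : ℝ) : ℂ) = ((1 / m : ℝ) : ℂ) := by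
  rw [← Complex.ofReal_mul, div_mul_div_comm, Real.mul_self_sqrt (by positivity), one_mul]

/-- The inner products of steering vectors are real, as the frequencies are symmetric about `0`. -/
theorem inner_wave (m : ℕ) (a b : ℝ) : ⟪wave m 0 a, wave m 0 b⟫_ℂ = (kern m (b - a) : ℂ) := by
  have h : ∀ l : Fin m, ⟪wave m 0 a l, wave m 0 b l⟫_ℂ = ((1 / m : ℝ) : ℂ) *
      ((cos (angFreq m l * (b - a)) : ℝ) + (sin (angFreq m l * (b - a)) : ℝ) * Complex.I) := by
    intro l
    rw [wave_apply, wave_apply, ← inv_sqrt_mul_self, Complex.ofReal_cos, Complex.ofReal_sin,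
      ← Complex.exp_mul_I]
    have e : ((angFreq m l * (b - a) : ℝ) : ℂ) * Complex.I =
        Complex.I * (angFreq m l : ℂ) * (b : ℂ) + -Complex.I * (angFreq m l : ℂ) * (a : ℂ) := by
      push_cast; ring
    rw [e, Complex.exp_add]
    simp only [RCLike.inner_apply, map_mul, pow_zero, mul_one, Complex.conj_ofReal,
      ← Complex.exp_conj, Complex.conj_I]
    ring
  rw [PiLp.inner_apply, Finset.sum_congr rfl fun l _ => h l, ← Finset.mul_sum,
    Finset.sum_add_distrib, ← Finset.sum_mul, ← Complex.ofReal_sum, ← Complex.ofReal_sum,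
    sum_sin_angFreq]
  unfold kern
  push_cast; ring

theorem inner_wave_one (m : ℕ) (a b : ℝ) :
    ⟪wave m 0 a, wave m 1 b⟫_ℂ = (kern1 m (b - a) : ℂ) := by
  have h1 : HasDerivAt (fun b => ⟪wave m 0 a, wave m 0 b⟫_ℂ) ⟪wave m 0 a, wave m 1 b⟫_ℂ b := by
    have := (hasDerivAt_const b (wave m 0 a)).inner ℂ (hasDerivAt_wave m 0 b)
    simpa using this
  have h2 : HasDerivAt (fun b => ⟪wave m 0 a, wave m 0 b⟫_ℂ) (kern1 m (b - a) : ℂ) b := by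
    simp only [inner_wave]
    have := (hasDerivAt_kern m (b - a)).comp b ((hasDerivAt_id b).sub_const a)
    simpa using this.ofReal_comp
  exact h1.unique h2

theorem norm_wave_sq (m n : ℕ) (v : ℝ) :
    ‖wave m n v‖ ^ 2 = (1 / m) * ∑ l : Fin m, angFreq m l ^ (2 * n) := by
  rw [EuclideanSpace.norm_sq_eq, Finset.mul_sum]
  refine Finset.sum_congr rfl fun l _ => ?_
  have e : ‖Complex.exp (Complex.I * (angFreq m l : ℂ) * (v : ℂ))‖ = 1 := by
    rw [show Complex.I * (angFreq m l : ℂ) * (v : ℂ) = ((angFreq m l * v : ℝ) : ℂ) * Complex.I by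
      push_cast; ring]
    exact Complex.norm_exp_ofReal_mul_I _
  rw [wave_apply, norm_mul, norm_mul, norm_pow, norm_mul, Complex.norm_I, one_mul, e, mul_one,
    Complex.norm_real, Complex.norm_real, mul_pow, ← pow_mul, mul_comm n 2, pow_mul, norm_eq_abs,
    norm_eq_abs, sq_abs, sq_abs, div_pow, Real.sq_sqrt (by positivity), one_pow, ← pow_mul]

theorem norm_wave_zero {m : ℕ} (hm : 0 < m) (v : ℝ) : ‖wave m 0 v‖ = 1 := by
  have h := norm_wave_sq m 0 v
  have hm' : (m : ℝ) ≠ 0 := by positivity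
  simp only [mul_zero, pow_zero, Finset.sum_const, Finset.card_univ, Fintype.card_fin,
    nsmul_eq_mul, mul_one] at h
  rw [one_div_mul_cancel hm'] at h
  exact (pow_eq_one_iff_of_nonneg (norm_nonneg _) two_ne_zero).1 h

theorem norm_wave_one_sq_le {m : ℕ} (hm : 0 < m) (v : ℝ) : ‖wave m 1 v‖ ^ 2 ≤ 1 / 3 := by
  rw [norm_wave_sq]; exact angFreq_moment_le hm

theorem norm_wave_two_sq_le {m : ℕ} (hm : 0 < m) (v : ℝ) : ‖wave m 2 v‖ ^ 2 ≤ 1 / 3 := by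
  rw [norm_wave_sq]; exact angFreq_fourth_moment_le hm

theorem steering_eq_wave {m : ℕ} (hm : 0 < m) (t : Torus) :
    steering m t = wave m 0 (m * rep t / 2) := by
  have hm' : (m : ℂ) ≠ 0 := by exact_mod_cast hm.ne'
  ext l
  rw [wave_apply]
  simp only [steering, pow_zero, mul_one]
  congr 2
  unfold angFreq
  push_cast
  field_simp

/-- Another real representative of a point of the torus changes the steering vector by a factor of
modulus one. -/
theorem exists_steering_coe {m : ℕ} (hm : 0 < m) (u : ℝ) :
    ∃ c : ℂ, ‖c‖ = 1 ∧ steering m (u : Torus) = c • wave m 0 (m * u / 2) := by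
  have hm' : (m : ℂ) ≠ 0 := by exact_mod_cast hm.ne'
  have h : ((rep (u : Torus) - u : ℝ) : Torus) = 0 := by
    rw [AddCircle.coe_sub, coe_rep, sub_self]
  obtain ⟨n, hn⟩ := AddCircle.coe_eq_zero_iff _ |>.1 h
  have hrep : rep (u : Torus) = u + n * (2 * π) := by
    rw [zsmul_eq_mul] at hn; linarith
  refine ⟨Complex.exp (((-((m : ℝ) - 1) * π * n : ℝ) : ℂ) * Complex.I),
    Complex.norm_exp_ofReal_mul_I _, ?_⟩
  rw [steering_eq_wave hm, hrep]
  ext l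
  rw [PiLp.smul_apply, wave_apply, wave_apply, smul_eq_mul,
    mul_left_comm (Complex.exp _), ← Complex.exp_add]
  congr 1
  rw [Complex.exp_eq_exp_iff_exists_int]
  refine ⟨n * (l : ℕ), ?_⟩
  unfold angFreq freqIndex
  push_cast
  field_simp
  ring

theorem landscape_coe {m : ℕ} (hm : 0 < m) (W : Submodule ℂ (EuclideanSpace ℂ (Fin m))) (u : ℝ) :
    landscape W (u : Torus) = 1 - ‖W.starProjection (wave m 0 (m * u / 2))‖ ^ 2 := by
  obtain ⟨c, hc, h⟩ := exists_steering_coe hm u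
  rw [landscape, h, map_smul, norm_smul, hc, one_mul]

/-- The columns of the Fourier matrix are `√m` times the steering vectors. -/
theorem fourierSubspace_eq_span {m s : ℕ} (hm : 0 < m) (x : Fin s → Torus) :
    fourierSubspace m x = Submodule.span ℂ (range fun j => wave m 0 (m * rep (x j) / 2)) := by
  have hm' : (√(m : ℝ) : ℂ) ≠ 0 := by
    have : √(m : ℝ) ≠ 0 := by positivity
    exact_mod_cast this
  have h : ∀ j, WithLp.toLp 2 ((fourierMatrix m x)ᵀ j) =
      (√(m : ℝ) : ℂ) • wave m 0 (m * rep (x j) / 2) := by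
    intro j
    rw [← steering_eq_wave hm]
    ext l
    simp only [PiLp.smul_apply, steering, smul_eq_mul, Matrix.transpose_apply, fourierMatrix,
      Matrix.of_apply]
    push_cast
    field_simp
  refine le_antisymm (Submodule.span_le.2 ?_) (Submodule.span_le.2 ?_)
  · rintro _ ⟨j, rfl⟩
    simp only [h]
    exact Submodule.smul_mem _ _ (Submodule.subset_span ⟨j, rfl⟩)
  · rintro _ ⟨j, rfl⟩
    change wave m 0 (m * rep (x j) / 2) ∈ _
    rw [show wave m 0 (m * rep (x j) / 2) = (√(m : ℝ) : ℂ)⁻¹ • WithLp.toLp 2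
      ((fourierMatrix m x)ᵀ j) by rw [h, inv_smul_smul₀ hm']]
    exact Submodule.smul_mem _ _ (Submodule.subset_span ⟨j, rfl⟩)

/-! ### The Gram matrix of separated steering vectors -/

/-- The lower half of Gershgorin's bound, for a real symmetric matrix with constant diagonal. -/
theorem gershgorin_le {s : ℕ} (K : Fin s → Fin s → ℝ) {d ε : ℝ} (hK : ∀ j k, K j k = K k j)
    (hd : ∀ j, K j j = d) (hε : ∀ j, ∑ k ∈ Finset.univ.erase j, |K j k| ≤ ε) (a : Fin s → ℂ) :
    (d - ε) * ∑ j, ‖a j‖ ^ 2 ≤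
      ∑ j, ∑ k, (starRingEnd ℂ (a j) * a k * (K j k : ℂ)).re := by
  have h1 : ∀ j, d * ‖a j‖ ^ 2 - ∑ k ∈ Finset.univ.erase j,
      (|K j k| * ‖a j‖ ^ 2 / 2 + |K k j| * ‖a k‖ ^ 2 / 2) ≤
      ∑ k, (starRingEnd ℂ (a j) * a k * (K j k : ℂ)).re := by
    intro j
    rw [← Finset.add_sum_erase _ _ (Finset.mem_univ j), sub_eq_add_neg, ← Finset.sum_neg_distrib]
    refine add_le_add (le_of_eq ?_) (Finset.sum_le_sum fun k _ => ?_)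
    · rw [hd, ← Complex.normSq_eq_conj_mul_self, ← Complex.ofReal_mul, Complex.ofReal_re,
        Complex.normSq_eq_norm_sq, mul_comm]
    · have h2 := (abs_le.1 (Complex.abs_re_le_norm (starRingEnd ℂ (a j) * a k * (K j k : ℂ)))).1
      rw [norm_mul, norm_mul, RCLike.norm_conj, Complex.norm_real, norm_eq_abs] at h2
      rw [hK k j]
      nlinarith [abs_nonneg (K j k), mul_nonneg (abs_nonneg (K j k)) (sq_nonneg (‖a j‖ - ‖a k‖))]
  refine le_trans ?_ (Finset.sum_le_sum fun j _ => h1 j)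
  have h3 : ∑ j, ∑ k ∈ Finset.univ.erase j, |K k j| * ‖a k‖ ^ 2 / 2 =
      ∑ j, ∑ k ∈ Finset.univ.erase j, |K j k| * ‖a j‖ ^ 2 / 2 := by
    refine Finset.sum_comm' fun j k => ?_
    simp [eq_comm]
  have h4 : ∀ j, ∑ k ∈ Finset.univ.erase j, |K j k| * ‖a j‖ ^ 2 / 2 ≤ ε * ‖a j‖ ^ 2 / 2 := by
    intro j
    rw [← Finset.sum_div, ← Finset.sum_mul]
    gcongr
    exact hε j
  simp only [Finset.sum_add_distrib, Finset.sum_sub_distrib, h3]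
  have h5 := Finset.sum_le_sum fun j (_ : j ∈ Finset.univ) => h4 j
  rw [← Finset.sum_div, ← Finset.mul_sum] at h5
  rw [← Finset.mul_sum, sub_mul]
  linarith

/-- The kernel of the steering vectors weighted by the cosine window `cos (π κ / 2)`; unlike `kern`
it decays quadratically. -/
noncomputable def windowKern (m : ℕ) (y : ℝ) : ℝ := (kern m (y + π / 2) + kern m (y - π / 2)) / 2

theorem windowKern_neg (m : ℕ) (y : ℝ) : windowKern m (-y) = windowKern m y := by
  unfold windowKern
  rw [show -y + π / 2 = -(y - π / 2) by ring, show -y - π / 2 = -(y + π / 2) by ring, kern_neg,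
    kern_neg, add_comm]

theorem le_windowKern_zero {m : ℕ} (hm : 0 < m) : 0.6366 ≤ windowKern m 0 := by
  have hm' : (m : ℝ) ≠ 0 := by positivity
  have h1 := mul_sin_mul_kern hm (π / 2)
  have h2 : windowKern m 0 = kern m (π / 2) := by
    unfold windowKern
    rw [zero_add, zero_sub, kern_neg]; ring
  have h3 : (m : ℝ) * sin (π / 2 / m) ≤ π / 2 := by
    calc (m : ℝ) * sin (π / 2 / m) ≤ m * (π / 2 / m) := by
          gcongr; exact sin_le (by positivity)
      _ = π / 2 := by field_simp
  have h4 : 0 ≤ sin (π / 2 / m) := by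
    refine sin_nonneg_of_nonneg_of_le_pi (by positivity) ?_
    rw [div_div]
    refine div_le_self pi_pos.le ?_
    have : (1 : ℝ) ≤ m := by exact_mod_cast hm
    linarith
  rw [sin_pi_div_two] at h1
  rw [h2]
  have h5 : 0 ≤ (m : ℝ) * sin (π / 2 / m) := by positivity
  have := pi_lt_d4
  by_contra h
  push Not at h
  nlinarith

/-- With `a = π / (2 m)` and `z = y / m`, `sin (z + a) sin (z - a) = sin² z - sin² a`; the
numerators of the two shifted kernels combine to `-2 m cos y cos z sin a`, and `m sin a ≤ π / 2`.
-/
theorem abs_windowKern_mul_le {m : ℕ} (hm : 0 < m) (y : ℝ) :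
    ((m * sin (y / m)) ^ 2 - 2.4675) * |windowKern m y| ≤ π / 2 := by
  have hm' : (m : ℝ) ≠ 0 := by positivity
  have h1 := mul_sin_mul_kern hm (y + π / 2)
  have h2 := mul_sin_mul_kern hm (y - π / 2)
  rw [sin_add_pi_div_two, add_div, sin_add] at h1
  rw [sin_sub_pi_div_two, sub_div, sin_sub] at h2
  have h3 : |m * sin (π / 2 / m)| ≤ π / 2 := by
    rw [abs_mul, abs_of_nonneg (by positivity : (0 : ℝ) ≤ m)]
    calc (m : ℝ) * |sin (π / 2 / m)| ≤ m * |π / 2 / m| := by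
          exact mul_le_mul_of_nonneg_left abs_sin_le_abs (by positivity)
      _ = π / 2 := by rw [abs_of_nonneg (by positivity)]; field_simp
  set S := sin (y / m)
  set c := cos (y / m)
  set σ := sin (π / 2 / m)
  set γ := cos (π / 2 / m)
  have hSc : S ^ 2 + c ^ 2 = 1 := sin_sq_add_cos_sq _
  have hσγ : σ ^ 2 + γ ^ 2 = 1 := sin_sq_add_cos_sq _
  have key : ((m * S) ^ 2 - (m * σ) ^ 2) * windowKern m y = -(cos y * c * (m * σ)) := by
    have e : (m * S) ^ 2 - (m * σ) ^ 2 = (m * (S * γ + c * σ)) * (m * (S * γ - c * σ)) := by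
      linear_combination (m : ℝ) ^ 2 * (S ^ 2 * -hσγ) + (m : ℝ) ^ 2 * σ ^ 2 * hSc
    rw [e]
    unfold windowKern
    linear_combination (m * (S * γ - c * σ)) / 2 * h1 + (m * (S * γ + c * σ)) / 2 * h2
  have h4 : |((m * S) ^ 2 - (m * σ) ^ 2) * windowKern m y| ≤ π / 2 := by
    rw [key, abs_neg, abs_mul, abs_mul]
    calc |cos y| * |c| * |m * σ| ≤ 1 * 1 * (π / 2) := by
          gcongr
          · exact abs_cos_le_one _
          · exact abs_cos_le_one _
      _ = π / 2 := by ring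
  have h5 : (m * σ) ^ 2 ≤ 2.4675 := by
    have := pi_lt_d4
    rw [← sq_abs]
    nlinarith [abs_nonneg (m * σ), pi_pos]
  refine le_trans ?_ h4
  rw [abs_mul]
  refine mul_le_mul_of_nonneg_right ?_ (abs_nonneg _)
  exact le_trans (by linarith) (le_abs_self _)

/-- At scaled distance at least `4 π` the windowed kernel is at most `1.6` times the bound for
`kern²`. -/
theorem abs_windowKern_le {m : ℕ} (hm : 100 ≤ m) {v : ℝ} (hv : 8 * π / m ≤ ‖(v : Torus)‖) :
    |windowKern m (m * v / 2)| ≤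
      1.6 * (1 / (m * ‖(v : Torus)‖ / 2) ^ 2 + 1 / (m : ℝ) ^ 2) := by
  have hm0 : 0 < m := by omega
  have hmR : (100 : ℝ) ≤ m := by exact_mod_cast hm
  have hm' : (m : ℝ) ≠ 0 := by positivity
  have hv0 : 0 < ‖(v : Torus)‖ := lt_of_lt_of_le (by positivity) hv
  obtain ⟨h1, h2⟩ := inv_mul_sin_sq_le hm0 (norm_pos_iff.1 hv0)
  have h3 := abs_windowKern_mul_le hm0 (m * v / 2)
  rw [show (m : ℝ) * v / 2 / m = v / 2 by field_simp] at h3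
  have h4 : 1 / (m * ‖(v : Torus)‖ / 2) ^ 2 + 1 / (m : ℝ) ^ 2 ≤ 1 / 155 := by
    have e1 : 4 * π ≤ m * ‖(v : Torus)‖ / 2 := by
      calc 4 * π = m * (8 * π / m) / 2 := by field_simp; ring
        _ ≤ _ := by gcongr
    have e2 : 1 / (m * ‖(v : Torus)‖ / 2) ^ 2 ≤ 1 / (4 * π) ^ 2 := by gcongr
    have e3 : 1 / (m : ℝ) ^ 2 ≤ 1 / 100 ^ 2 := by gcongr
    have e4 : 1 / (4 * π) ^ 2 ≤ 1 / (4 * 3.1415) ^ 2 := by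
      have := pi_gt_d4
      gcongr
    have : (1 : ℝ) / (4 * 3.1415) ^ 2 + 1 / 100 ^ 2 ≤ 1 / 155 := by norm_num
    linarith
  refine le_trans ?_ (mul_le_mul_of_nonneg_left h2 (by norm_num))
  set M := (m * sin (v / 2)) ^ 2
  have h5 : 155 ≤ M := by
    have := h2.trans h4
    rwa [one_div_le_one_div h1 (by norm_num)] at this
  rw [mul_one_div, le_div_iff₀ h1]
  have := pi_lt_d4
  have h6 : M ≤ 155 / (155 - 2.4675) * (M - 2.4675) := by
    norm_num; linarith
  calc |windowKern m (m * v / 2)| * M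
      ≤ |windowKern m (m * v / 2)| * (155 / (155 - 2.4675) * (M - 2.4675)) := by gcongr
    _ = 155 / (155 - 2.4675) * ((M - 2.4675) * |windowKern m (m * v / 2)|) := by ring
    _ ≤ 155 / (155 - 2.4675) * (3.1416 / 2) := by gcongr; linarith
    _ ≤ 1.6 := by norm_num

theorem wave_window (m : ℕ) (v : ℝ) (l : Fin m) :
    wave m 0 (v + π / 2) l + wave m 0 (v - π / 2) l =
      2 * (cos (angFreq m l * (π / 2)) : ℂ) * wave m 0 v l := by
  simp only [wave_apply, pow_zero, mul_one]
  rw [Complex.ofReal_cos, Complex.two_cos]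
  rw [show Complex.I * (angFreq m l : ℂ) * ((v + π / 2 : ℝ) : ℂ) =
      Complex.I * (angFreq m l : ℂ) * v + ((angFreq m l * (π / 2) : ℝ) : ℂ) * Complex.I by
    push_cast; ring, show Complex.I * (angFreq m l : ℂ) * ((v - π / 2 : ℝ) : ℂ) =
      Complex.I * (angFreq m l : ℂ) * v + -((angFreq m l * (π / 2) : ℝ) : ℂ) * Complex.I by
    push_cast; ring, Complex.exp_add, Complex.exp_add]
  ring

/-- The sum of the bounds for `kern²` over the frequencies other than `x j`. -/
theorem separated_sum_le {s m : ℕ} (hm : 100 ≤ m) (x : Fin s → Torus)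
    (hx : ∀ j k, j ≠ k → 8 * π / m ≤ dist (x j) (x k)) (j : Fin s) :
    ∑ k ∈ Finset.univ.erase j, (1 / (m * dist (x j) (x k) / 2) ^ 2 + 1 / (m : ℝ) ^ 2)
      ≤ 0.02383 := by
  have hmR : (100 : ℝ) ≤ m := by exact_mod_cast hm
  have h := sum_decay_le (Finset.univ.erase j) x (x j) hm (a := 8 * π / m) (δ := 0) (A := 4 * π)
    (fun k _ l _ hkl => hx k l hkl) (fun k hk => hx j k (Finset.ne_of_mem_erase hk).symm)
    (by positivity) (by positivity) (by field_simp; ring)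
  simp only [sub_zero] at h
  refine h.trans ?_
  have e1 : 1 / (4 * π) ^ 2 ≤ 1 / (4 * 3.1415) ^ 2 := by
    have := pi_gt_d4
    gcongr
  have e2 : 1 / (4 * π * (4 * π + 2 * π)) ≤ 1 / (4 * 3.1415 * (4 * 3.1415 + 2 * 3.1415)) := by
    have := pi_gt_d4
    gcongr
  have : (2 : ℝ) * (1 / (4 * 3.1415) ^ 2 + 1 / (4 * 3.1415 * (4 * 3.1415 + 2 * 3.1415))) + 0.0027
      ≤ 0.02383 := by norm_num
  linarith

/-- Riesz lower bound for separated steering vectors: weighting the coordinates by the cosine window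
can only decrease the norm, and makes the Gram matrix diagonally dominant. -/
theorem riesz_lower_bound {s m : ℕ} (hm : 100 ≤ m) (x : Fin s → Torus)
    (hx : ∀ j k, j ≠ k → 8 * π / m ≤ dist (x j) (x k)) (a : Fin s → ℂ) :
    0.598 * ∑ j, ‖a j‖ ^ 2 ≤ ‖∑ j, a j • wave m 0 (m * rep (x j) / 2)‖ ^ 2 := by
  have hm0 : 0 < m := by omega
  set η : Fin s → ℝ := fun j => m * rep (x j) / 2 with hη
  have hε : ∀ j, ∑ k ∈ Finset.univ.erase j, |windowKern m (η k - η j)| ≤ 0.0382 := by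
    intro j
    have h1 : ∀ k ∈ Finset.univ.erase j, |windowKern m (η k - η j)| ≤
        1.6 * (1 / (m * dist (x j) (x k) / 2) ^ 2 + 1 / (m : ℝ) ^ 2) := by
      intro k hk
      have e : ‖((rep (x k) - rep (x j) : ℝ) : Torus)‖ = dist (x j) (x k) := by
        rw [AddCircle.coe_sub, coe_rep, coe_rep, ← dist_eq_norm, dist_comm]
      have h2 := abs_windowKern_le hm (v := rep (x k) - rep (x j))
        (by rw [e]; exact hx j k (Finset.ne_of_mem_erase hk).symm)
      rw [e] at h2
      rwa [show η k - η j = m * (rep (x k) - rep (x j)) / 2 by simp only [hη]; ring]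
    refine (Finset.sum_le_sum h1).trans ?_
    rw [← Finset.mul_sum]
    linarith [separated_sum_le hm x hx j]
  have hg := gershgorin_le (fun j k => windowKern m (η k - η j)) (d := windowKern m 0)
    (fun j k => by rw [← windowKern_neg, neg_sub]) (fun j => by rw [sub_self]) hε a
  set V := ∑ j, a j • wave m 0 (η j) with hV
  have hV' : ∑ j, ∑ k, (starRingEnd ℂ (a j) * a k * (windowKern m (η k - η j) : ℂ)).re =
      (⟪V, (1 / 2 : ℂ) • ∑ k, a k • (wave m 0 (η k + π / 2) + wave m 0 (η k - π / 2))⟫_ℂ).re := by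
    rw [hV, sum_inner, Complex.re_sum]
    refine Finset.sum_congr rfl fun j _ => ?_
    rw [inner_smul_left, inner_smul_right, inner_sum, Finset.mul_sum, Finset.mul_sum,
      Complex.re_sum]
    refine Finset.sum_congr rfl fun k _ => ?_
    rw [inner_smul_right, inner_add_right, inner_wave, inner_wave, windowKern,
      show η k + π / 2 - η j = η k - η j + π / 2 by ring,
      show η k - π / 2 - η j = η k - η j - π / 2 by ring]
    congr 1
    push_cast; ring
  have hcoord : ∀ l, ((1 / 2 : ℂ) • ∑ k, a k • (wave m 0 (η k + π / 2) + wave m 0 (η k - π / 2))) l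
      = (cos (angFreq m l * (π / 2)) : ℂ) * V l := by
    intro l
    rw [hV]
    simp only [PiLp.smul_apply, WithLp.ofLp_sum, Finset.sum_apply, PiLp.add_apply, smul_eq_mul,
      wave_window, Finset.mul_sum]
    refine Finset.sum_congr rfl fun k _ => ?_
    ring
  have hle : (⟪V, (1 / 2 : ℂ) • ∑ k, a k • (wave m 0 (η k + π / 2) + wave m 0 (η k - π / 2))⟫_ℂ).re
      ≤ ‖V‖ ^ 2 := by
    rw [PiLp.inner_apply, Complex.re_sum, EuclideanSpace.norm_sq_eq]
    refine Finset.sum_le_sum fun l _ => ?_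
    rw [hcoord, RCLike.inner_apply, mul_assoc,
      ← Complex.normSq_eq_conj_mul_self.trans (mul_comm _ _),
      ← Complex.ofReal_mul, Complex.ofReal_re, Complex.normSq_eq_norm_sq]
    exact mul_le_of_le_one_left (sq_nonneg _) (cos_le_one _)
  have h0 := le_windowKern_zero hm0
  rw [hV'] at hg
  refine le_trans ?_ (hg.trans hle)
  gcongr
  linarith

/-- Upper frame bound for the projection onto the Fourier subspace. -/
theorem norm_starProjection_sq_le {s m : ℕ} (hm : 100 ≤ m) (x : Fin s → Torus)
    (hx : ∀ j k, j ≠ k → 8 * π / m ≤ dist (x j) (x k)) (v : EuclideanSpace ℂ (Fin m)) :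
    0.598 * ‖(fourierSubspace m x).starProjection v‖ ^ 2 ≤
      ∑ k, ‖⟪wave m 0 (m * rep (x k) / 2), v⟫_ℂ‖ ^ 2 := by
  have hm0 : 0 < m := by omega
  set P := (fourierSubspace m x).starProjection
  have hmem : P v ∈ fourierSubspace m x := Submodule.starProjection_apply_mem _ v
  rw [fourierSubspace_eq_span hm0, Submodule.mem_span_range_iff_exists_fun] at hmem
  obtain ⟨a, ha⟩ := hmem
  have h1 := riesz_lower_bound hm x hx a
  rw [ha] at h1
  have h2 : ‖P v‖ ^ 2 = (∑ k, starRingEnd ℂ (a k) * ⟪wave m 0 (m * rep (x k) / 2), v⟫_ℂ).re := by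
    have e1 : (⟪P v, v⟫_ℂ).re = ‖P v‖ ^ 2 :=
      Submodule.re_inner_starProjection_eq_normSq (𝕜 := ℂ) (K := fourierSubspace m x) v
    rw [← e1, ← ha, sum_inner]
    simp only [inner_smul_left]
  have h3 : ‖P v‖ ^ 2 ≤ ∑ k, ‖a k‖ * ‖⟪wave m 0 (m * rep (x k) / 2), v⟫_ℂ‖ := by
    rw [h2]
    refine (Complex.re_le_norm _).trans ((norm_sum_le _ _).trans (Finset.sum_le_sum fun k _ => ?_))
    rw [norm_mul, RCLike.norm_conj]
  have h4 := Finset.sum_mul_sq_le_sq_mul_sq Finset.univ (fun k => ‖a k‖)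
    (fun k => ‖⟪wave m 0 (m * rep (x k) / 2), v⟫_ℂ‖)
  set N := ‖P v‖ ^ 2
  have hN : 0 ≤ N := by positivity
  set C := ∑ k, ‖⟪wave m 0 (m * rep (x k) / 2), v⟫_ℂ‖ ^ 2
  have hC : 0 ≤ C := Finset.sum_nonneg fun _ _ => by positivity
  set B := ∑ k, ‖a k‖ ^ 2
  have h5 : N ^ 2 ≤ B * C := (pow_le_pow_left₀ hN h3 2).trans h4
  rcases hN.eq_or_lt with h | h
  · rw [← h]; simpa using hC
  · have h6 : N * (0.598 * N) ≤ N * C := by nlinarith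
    exact le_of_mul_le_mul_left h6 h

/-! ### The landscape near a true frequency -/

theorem hasDerivAt_re_inner {m : ℕ} {f g : ℝ → EuclideanSpace ℂ (Fin m)}
    {f' g' : EuclideanSpace ℂ (Fin m)} {y : ℝ} (hf : HasDerivAt f f' y) (hg : HasDerivAt g g' y) :
    HasDerivAt (fun y => (⟪f y, g y⟫_ℂ).re) ((⟪f y, g'⟫_ℂ).re + (⟪f', g y⟫_ℂ).re) y := by
  exact Complex.reCLM.hasFDerivAt.comp_hasDerivAt y (hf.inner ℂ hg)

theorem abs_re_inner_le {m : ℕ} (u v : EuclideanSpace ℂ (Fin m)) :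
    |(⟪u, v⟫_ℂ).re| ≤ ‖u‖ * ‖v‖ :=
  (Complex.abs_re_le_norm _).trans (norm_inner_le_norm u v)

/-- The component of the steering curve, or of its derivatives, orthogonal to the steering vector at
the parameter `η`. -/
noncomputable def chi (m n : ℕ) (η y : ℝ) : EuclideanSpace ℂ (Fin m) :=
  wave m n (η + y) - ⟪wave m 0 η, wave m n (η + y)⟫_ℂ • wave m 0 η

theorem hasDerivAt_wave_add (m n : ℕ) (η y : ℝ) :
    HasDerivAt (fun y => wave m n (η + y)) (wave m (n + 1) (η + y)) y := by
  have h := (hasDerivAt_wave m n (η + y)).scomp y ((hasDerivAt_id y).const_add η)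
  exact h.congr_deriv (one_smul ℝ _)

theorem hasDerivAt_chi (m n : ℕ) (η y : ℝ) :
    HasDerivAt (chi m n η) (chi m (n + 1) η y) y := by
  have h1 := hasDerivAt_wave_add m n η y
  have h2 : HasDerivAt (fun y => ⟪wave m 0 η, wave m n (η + y)⟫_ℂ)
      ⟪wave m 0 η, wave m (n + 1) (η + y)⟫_ℂ y := by
    have := (hasDerivAt_const y (wave m 0 η)).inner ℂ h1
    simpa using this
  exact h1.sub (h2.smul_const _)

theorem chi_zero_zero {m : ℕ} (hm : 0 < m) (η : ℝ) : chi m 0 η 0 = 0 := by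
  rw [chi, add_zero, inner_wave, sub_self, kern_zero hm, Complex.ofReal_one, one_smul, sub_self]

/-- `chi` is the orthogonal projection of `wave` onto the complement of a unit vector. -/
theorem norm_chi_le {m : ℕ} (hm : 0 < m) (n : ℕ) (η y : ℝ) :
    ‖chi m n η y‖ ≤ ‖wave m n (η + y)‖ := by
  have he := norm_wave_zero hm η
  set e := wave m 0 η
  set w := wave m n (η + y)
  have h1 : ⟪chi m n η y, ⟪e, w⟫_ℂ • e⟫_ℂ = 0 := by
    have : ⟪e, chi m n η y⟫_ℂ = 0 := by
      simp only [chi]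
      rw [inner_sub_right, inner_smul_right, inner_self_eq_norm_sq_to_K, he]; simp [e]
    rw [inner_smul_right, ← inner_conj_symm (chi m n η y) e, this, map_zero, mul_zero]
  have h2 : w = chi m n η y + ⟪e, w⟫_ℂ • e := by simp [chi, e, w]
  have h3 := norm_add_sq_eq_norm_sq_add_norm_sq_of_inner_eq_zero _ _ h1
  rw [← h2] at h3
  nlinarith [norm_nonneg w, norm_nonneg (chi m n η y), norm_nonneg (⟪e, w⟫_ℂ • e)]

section Near

variable {s m : ℕ} (x : Fin s → Torus) (j : Fin s)

theorem wave_mem_fourierSubspace (hm : 0 < m) :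
    wave m 0 (m * rep (x j) / 2) ∈ fourierSubspace m x := by
  rw [fourierSubspace_eq_span hm]
  exact Submodule.subset_span ⟨j, rfl⟩

/-- Splitting off the direction of the steering vector at `x j`. -/
theorem norm_starProjection_wave_sq (hm : 0 < m) (y : ℝ) :
    ‖(fourierSubspace m x).starProjection (wave m 0 (m * rep (x j) / 2 + y))‖ ^ 2 =
      kern m y ^ 2 +
      ‖(fourierSubspace m x).starProjection (chi m 0 (m * rep (x j) / 2) y)‖ ^ 2 := by
  have hmem := wave_mem_fourierSubspace x j hm
  set η := (m : ℝ) * rep (x j) / 2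
  have he := norm_wave_zero hm η
  set P := (fourierSubspace m x).starProjection
  have hPe : P (wave m 0 η) = wave m 0 η := Submodule.starProjection_eq_self_iff.2 hmem
  have h1 : ⟪wave m 0 η, P (chi m 0 η y)⟫_ℂ = 0 := by
    have h2 : ⟪P (wave m 0 η), chi m 0 η y⟫_ℂ = ⟪wave m 0 η, P (chi m 0 η y)⟫_ℂ :=
      Submodule.inner_starProjection_left_eq_right _ _ _
    rw [← h2, hPe, chi, inner_sub_right, inner_smul_right, inner_self_eq_norm_sq_to_K, he]; simp
  have h3 : P (wave m 0 (η + y)) = (kern m y : ℂ) • wave m 0 η + P (chi m 0 η y) := by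
    rw [chi, map_sub, map_smul, hPe, inner_wave, add_sub_cancel_left, add_sub_cancel]
  have h4 : ⟪(kern m y : ℂ) • wave m 0 η, P (chi m 0 η y)⟫_ℂ = 0 := by
    rw [inner_smul_left, h1, mul_zero]
  have h5 := norm_add_sq_eq_norm_sq_add_norm_sq_of_inner_eq_zero _ _ h4
  rw [h3, sq, h5, norm_smul, he, Complex.norm_real, norm_eq_abs, mul_one, abs_mul_abs_self]
  ring

/-- Moving by `y` from `x j` changes the scaled distance to `x k` by at most `|y|`. -/
theorem dist_sub_le_norm (y : ℝ) (k : Fin s) (hm : 0 < m) :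
    m * dist (x j) (x k) / 2 - |y| ≤
      m * ‖((rep (x j) + 2 * y / m - rep (x k) : ℝ) : Torus)‖ / 2 := by
  have hm' : (0 : ℝ) < m := by positivity
  have e : x j - x k = ((rep (x j) + 2 * y / m - rep (x k) : ℝ) : Torus)
      - ((2 * y / m : ℝ) : Torus) := by
    rw [AddCircle.coe_sub, AddCircle.coe_add, coe_rep, coe_rep]; abel
  have h1 : dist (x j) (x k) ≤ ‖((rep (x j) + 2 * y / m - rep (x k) : ℝ) : Torus)‖
      + |2 * y / m| := by
    rw [dist_eq_norm, e]
    exact (norm_sub_le _ _).trans (add_le_add le_rfl (norm_coe_torus_le _))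
  rw [abs_div, abs_mul, abs_two, abs_of_pos hm'] at h1
  have h2 := mul_le_mul_of_nonneg_left h1 hm'.le
  have h3 : (m : ℝ) * (‖((rep (x j) + 2 * y / m - rep (x k) : ℝ) : Torus)‖ + 2 * |y| / m) =
      m * ‖((rep (x j) + 2 * y / m - rep (x k) : ℝ) : Torus)‖ + 2 * |y| := by field_simp
  linarith

/-- The frequencies other than `x j` perturb the landscape little near `x j`. -/
theorem norm_starProjection_chi_one_sq_le (hm : 100 ≤ m)
    (hx : ∀ j k, j ≠ k → 8 * π / m ≤ dist (x j) (x k)) {y : ℝ} (hy : |y| ≤ 1.75) :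
    ‖(fourierSubspace m x).starProjection (chi m 1 (m * rep (x j) / 2) y)‖ ^ 2 ≤ 0.1 := by
  have hm0 : 0 < m := by omega
  have hmR : (100 : ℝ) ≤ m := by exact_mod_cast hm
  have hm' : (m : ℝ) ≠ 0 := by positivity
  have hπ := pi_gt_d4
  have hframe := norm_starProjection_sq_le hm x hx (chi m 1 (m * rep (x j) / 2) y)
  set η := (m : ℝ) * rep (x j) / 2 with hη
  have hin : ∀ k, ‖⟪wave m 0 (m * rep (x k) / 2), chi m 1 η y⟫_ℂ‖ ^ 2 =
      (kern1 m (η + y - m * rep (x k) / 2) - kern1 m y * kern m (η - m * rep (x k) / 2)) ^ 2 := by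
    intro k
    rw [chi, inner_sub_right, inner_smul_right, inner_wave_one, inner_wave_one, inner_wave,
      add_sub_cancel_left, ← Complex.ofReal_mul, ← Complex.ofReal_sub, Complex.norm_real,
      norm_eq_abs, sq_abs]
  rw [Finset.sum_congr rfl fun k _ => hin k, ← Finset.add_sum_erase _ _ (Finset.mem_univ j),
    ← hη, add_sub_cancel_left, sub_self, kern_zero hm0, mul_one, sub_self, zero_pow two_ne_zero,
    zero_add] at hframe
  have hk1 := kern1_sq_le hm hy
  have hterm : ∀ k ∈ Finset.univ.erase j,
      (kern1 m (η + y - m * rep (x k) / 2) - kern1 m y * kern m (η - m * rep (x k) / 2)) ^ 2 ≤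
      1.389 * 1.0087 * (1 / (m * dist (x j) (x k) / 2 - 1.75) ^ 2 + 1 / (m : ℝ) ^ 2) +
      3.571 * 0.186 * (1 / (m * dist (x j) (x k) / 2) ^ 2 + 1 / (m : ℝ) ^ 2) := by
    intro k hk
    have hjk := hx j k (Finset.ne_of_mem_erase hk).symm
    have hmd : 4 * π ≤ m * dist (x j) (x k) / 2 := by
      calc 4 * π = m * (8 * π / m) / 2 := by field_simp; ring
        _ ≤ _ := by gcongr
    have hd := dist_sub_le_norm x j y k hm0
    set p := 1 / (m * dist (x j) (x k) / 2 - 1.75) ^ 2 + 1 / (m : ℝ) ^ 2 with hp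
    have hp1 : p ≤ 0.0087 := by
      have e1 : 1 / (m * dist (x j) (x k) / 2 - 1.75) ^ 2 ≤ 1 / (4 * 3.1415 - 1.75) ^ 2 := by
        gcongr; linarith
      have e2 : 1 / (m : ℝ) ^ 2 ≤ 1 / 100 ^ 2 := by gcongr
      have : (1 : ℝ) / (4 * 3.1415 - 1.75) ^ 2 + 1 / 100 ^ 2 ≤ 0.0087 := by norm_num
      linarith
    have hp0 : 0 ≤ p := by positivity
    have h1 : kern1 m (η + y - m * rep (x k) / 2) ^ 2 ≤ p * (1 + p) := by
      set v := rep (x j) + 2 * y / m - rep (x k)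
      have hv : 0 < ‖(v : Torus)‖ := by
        by_contra hcon
        push Not at hcon
        have : (m : ℝ) * ‖(v : Torus)‖ / 2 ≤ 0 := by
          have := mul_nonpos_of_nonneg_of_nonpos (by positivity : (0 : ℝ) ≤ m) hcon
          linarith
        linarith
      have e : η + y - m * rep (x k) / 2 = m * v / 2 := by
        simp only [hη, v]; field_simp
      rw [e]
      refine kern1_sq_le_decay hm0 (norm_pos_iff.1 hv) ?_
      rw [hp]
      have : (0 : ℝ) < m * dist (x j) (x k) / 2 - 1.75 := by linarith
      gcongr
      linarith
    have h2 : kern m (η - m * rep (x k) / 2) ^ 2 ≤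
        1 / (m * dist (x j) (x k) / 2) ^ 2 + 1 / (m : ℝ) ^ 2 := by
      have e1 : ((rep (x j) - rep (x k) : ℝ) : Torus) = x j - x k := by
        rw [AddCircle.coe_sub, coe_rep, coe_rep]
      have e2 : η - m * rep (x k) / 2 = m * (rep (x j) - rep (x k)) / 2 := by
        simp only [hη]; ring
      have hne : ((rep (x j) - rep (x k) : ℝ) : Torus) ≠ 0 := by
        rw [e1, sub_ne_zero]
        intro h
        rw [h, dist_self, mul_zero, zero_div] at hmd
        linarith
      rw [e2]
      have h := kern_sq_le_decay hm0 hne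
      rwa [e1, ← dist_eq_norm] at h
    set a := kern1 m (η + y - m * rep (x k) / 2)
    set b := kern m (η - m * rep (x k) / 2)
    set c := kern1 m y
    -- Young's inequality, with weights close to the optimal ones
    have h3 : (a - c * b) ^ 2 ≤ 1.389 * a ^ 2 + 3.571 * (c ^ 2 * b ^ 2) := by
      nlinarith [sq_nonneg (0.389 * a + c * b), sq_nonneg (c * b)]
    have h4 : c ^ 2 * b ^ 2 ≤ 0.186 * (1 / (m * dist (x j) (x k) / 2) ^ 2 + 1 / (m : ℝ) ^ 2) := by
      gcongr
    have h5 : p * (1 + p) ≤ 1.0087 * p := by nlinarith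
    linarith
  have hs2 := separated_sum_le hm x hx j
  have hs1 := sum_decay_le (Finset.univ.erase j) x (x j) hm (a := 8 * π / m) (δ := 1.75)
    (A := 4 * π - 1.75) (fun k _ l _ hkl => hx k l hkl)
    (fun k hk => hx j k (Finset.ne_of_mem_erase hk).symm)
    (by positivity) (by linarith) (by field_simp; ring)
  have e1 : 1 / (4 * π - 1.75) ^ 2 ≤ 1 / (4 * 3.1415 - 1.75) ^ 2 := by gcongr
  have e2 : 1 / (4 * π * (4 * π - 1.75 + 2 * π)) ≤
      1 / (4 * 3.1415 * (4 * 3.1415 - 1.75 + 2 * 3.1415)) := by gcongr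
  have e3 : (2 : ℝ) * (1 / (4 * 3.1415 - 1.75) ^ 2 +
      1 / (4 * 3.1415 * (4 * 3.1415 - 1.75 + 2 * 3.1415))) + 0.0027 ≤ 0.02911 := by norm_num
  have hsum := Finset.sum_le_sum hterm
  rw [Finset.sum_add_distrib, ← Finset.mul_sum, ← Finset.mul_sum] at hsum
  linarith

/-- Integrate the bound for `χ'` from `0`, where `χ` vanishes. -/
theorem norm_starProjection_chi_le (hm : 100 ≤ m)
    (hx : ∀ j k, j ≠ k → 8 * π / m ≤ dist (x j) (x k)) {y : ℝ} (hy : |y| ≤ 1.75) :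
    ‖(fourierSubspace m x).starProjection (chi m 0 (m * rep (x j) / 2) y)‖ ≤ 0.3163 * |y| := by
  have hm0 : 0 < m := by omega
  set P := (fourierSubspace m x).starProjection
  set η := (m : ℝ) * rep (x j) / 2
  have hd : ∀ y, HasDerivAt (fun y => P (chi m 0 η y)) (P (chi m 1 η y)) y := fun y =>
    (P.restrictScalars ℝ).hasFDerivAt.comp_hasDerivAt y (hasDerivAt_chi m 0 η y)
  have h := Convex.norm_image_sub_le_of_norm_hasDerivWithin_le (C := 0.3163)
    (s := Icc (-1.75 : ℝ) 1.75) (x := 0) (y := y)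
    (fun t _ => (hd t).hasDerivWithinAt) (fun t ht => ?_) (convex_Icc _ _) (by norm_num)
    (abs_le.1 hy)
  · simpa [chi_zero_zero hm0] using h
  · have h1 := norm_starProjection_chi_one_sq_le x j hm hx (abs_le.2 ht)
    have h2 : ‖P (chi m 1 η t)‖ ^ 2 ≤ 0.3163 ^ 2 := h1.trans (by norm_num)
    exact le_of_sq_le_sq h2 (by norm_num)

end Near

/-- The main term `-2 kern kern1` of the derivative of the landscape is `y` times a factor bounded
from above and below. -/
theorem exists_slope {m : ℕ} (hm : 100 ≤ m) {y : ℝ} (hy : |y| ≤ 1.75) :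
    ∃ T, 0.268 ≤ T ∧ T ≤ 0.667 ∧ (|y| ≤ 0.4 → 0.6 ≤ T) ∧ -2 * (kern m y * kern1 m y) = y * T := by
  have hm0 : 0 < m := by omega
  have hpos : ∀ y : ℝ, 0 < y → y ≤ 1.75 →
      ∃ T, 0.268 ≤ T ∧ T ≤ 0.667 ∧ (y ≤ 0.4 → 0.6 ≤ T) ∧ -2 * (kern m y * kern1 m y) = y * T := by
    intro y h0 h1
    obtain ⟨h2, h3, h4⟩ := kern_slope hm h0 h1
    have h5 := (abs_le.1 (abs_kern1_le hm0 y)).1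
    rw [abs_of_pos h0] at h5
    have h6 := (abs_le.1 (abs_kern_le_one hm0 y)).2
    refine ⟨2 * (kern m y * (-kern1 m y / y)), ?_, ?_, fun h => ?_, by field_simp⟩
    · have : 0.24 ≤ -kern1 m y / y := by rwa [le_div_iff₀ h0]
      nlinarith
    · have e1 : -kern1 m y / y ≤ 1 / 3 := by rw [div_le_iff₀ h0]; linarith
      have e2 : 0 ≤ -kern1 m y / y := div_nonneg (by linarith) h0.le
      nlinarith
    · have e1 : 0.325 ≤ -kern1 m y / y := by rw [le_div_iff₀ h0]; exact h4 h
      have e2 := one_sub_le_kern hm0 y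
      have e3 : 0.97 ≤ kern m y := by nlinarith
      nlinarith
  rcases lt_trichotomy y 0 with h | h | h
  · obtain ⟨T, h1, h2, h3, h4⟩ := hpos (-y) (by linarith) (by rwa [abs_of_neg h] at hy)
    refine ⟨T, h1, h2, by rwa [abs_of_neg h], ?_⟩
    rw [kern_neg, kern1_neg] at h4
    linarith
  · refine ⟨0.65, by norm_num, by norm_num, fun _ => by norm_num, ?_⟩
    have := abs_kern1_le hm0 y
    rw [h, abs_zero, zero_div] at this
    rw [h, abs_nonpos_iff.1 this]; simp
  · obtain ⟨T, h1, h2, h3, h4⟩ := hpos y h (by rwa [abs_of_pos h] at hy)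
    exact ⟨T, h1, h2, by rwa [abs_of_pos h], h4⟩

/-! ### One-dimensional analysis: gradient descent near a perturbed minimum -/

/-- A function whose derivative on `[-1.75, 1.75]` is `y T`, where `T ≥ 0.268`, up to an error of
at most `0.201 |y| + 1.16 θ`, and which is convex on `[-0.4, 0.4]`, has a local minimum near `0`
towards which gradient steps of size `1.5` contract. -/
theorem exists_localMin_contraction {F F1 F2 : ℝ → ℝ} {θ : ℝ} (h0 : 0 ≤ θ) (hθ : θ ≤ 0.01)
    (hF : ∀ y, HasDerivAt F (F1 y) y) (hF1 : ∀ y, HasDerivAt F1 (F2 y) y)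
    (ha : ∀ y, |y| ≤ 1.75 → ∃ T, 0.268 ≤ T ∧ T ≤ 0.667 ∧ (|y| ≤ 0.4 → 0.6 ≤ T) ∧
      |F1 y - y * T| ≤ 0.201 * |y| + 1.16 * θ)
    (hb : ∀ y, |y| ≤ 0.4 → 0.11 ≤ F2 y ∧ F2 y ≤ 1.2)
    (hc0 : F 0 ≤ θ) (hc : ∀ y, |y| = 0.4 → θ < F y) :
    ∃ z, |z| ≤ 3.5 * θ ∧ IsLocalMin F z ∧
      (∀ y, |y| ≤ 1.75 → |y - 1.5 * F1 y - z| ≤ 0.95 * |y - z|) ∧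
      (∀ y, |y| ≤ 0.4 → |y - 1.5 * F1 y - z| ≤ 0.839 * |y - z|) := by
  obtain ⟨z, hz, hmin⟩ := isCompact_Icc.exists_isMinOn (nonempty_Icc.2 (by norm_num :
    (-0.4 : ℝ) ≤ 0.4)) (fun y _ => (hF y).continuousAt.continuousWithinAt)
  have hz0 : F z ≤ θ :=
    (hmin (show (0 : ℝ) ∈ Icc (-0.4 : ℝ) 0.4 by constructor <;> norm_num)).trans hc0
  have hzabs : |z| < 0.4 := by
    rcases (abs_le.2 hz).lt_or_eq with h | h
    · exact h
    · linarith [hc z h]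
  -- `F ≤ θ` at `0` but not at the ends of the interval, so the minimiser is an interior point
  have hloc : IsLocalMin F z := hmin.isLocalMin (Icc_mem_nhds (abs_lt.1 hzabs).1 (abs_lt.1 hzabs).2)
  have hF1z : F1 z = 0 := hloc.hasDerivAt_eq_zero (hF z)
  have hz1 : |z| ≤ 3.5 * θ := by
    obtain ⟨T, _, _, h3, h4⟩ := ha z (by linarith)
    have h3 := h3 hzabs.le
    rw [hF1z, zero_sub, abs_neg, abs_mul, abs_of_nonneg (by linarith : 0 ≤ T)] at h4
    nlinarith [abs_nonneg z]
  have hinner : ∀ y, |y| ≤ 0.4 → |y - 1.5 * F1 y - z| ≤ 0.839 * |y - z| := by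
    intro y hy
    have hd : ∀ y, HasDerivAt (fun y => y - 1.5 * F1 y) (1 - 1.5 * F2 y) y := fun y =>
      (hasDerivAt_id y).sub ((hF1 y).const_mul 1.5)
    have h := Convex.norm_image_sub_le_of_norm_hasDerivWithin_le (C := 0.839)
      (s := Icc (-0.4 : ℝ) 0.4) (x := z) (y := y)
      (fun t _ => (hd t).hasDerivWithinAt) (fun t ht => ?_) (convex_Icc _ _) hz (abs_le.1 hy)
    · simp only [hF1z, norm_eq_abs] at h
      rwa [mul_zero, sub_zero] at h
    · obtain ⟨h1, h2⟩ := hb t (abs_le.2 ht)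
      rw [norm_eq_abs, abs_le]
      constructor <;> linarith
  refine ⟨z, hz1, hloc, fun y hy => ?_, hinner⟩
  by_cases hy4 : |y| ≤ 0.4
  · refine (hinner y hy4).trans ?_
    gcongr
    norm_num
  push Not at hy4
  obtain ⟨T, h1, h2, _, h4⟩ := ha y hy
  have hz2 : |z| ≤ 0.035 := by linarith
  obtain ⟨hz3, hz4⟩ := abs_le.1 hz2
  obtain ⟨h5, h6⟩ := abs_le.1 h4
  rcases le_or_gt 0 y with hy0 | hy0
  · rw [abs_of_nonneg hy0] at *
    have e1 : y * 0.268 ≤ y * T := by gcongr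
    have e2 : y * T ≤ y * 0.667 := by gcongr
    rw [abs_of_nonneg (by linarith : 0 ≤ y - z), abs_le]
    constructor <;> linarith
  · rw [abs_of_neg hy0] at *
    have e1 : y * T ≤ y * 0.268 := by nlinarith
    have e2 : y * 0.667 ≤ y * T := by nlinarith
    rw [abs_of_neg (by linarith : y - z < 0), abs_le]
    constructor <;> linarith

/-- After `31` steps at rate `0.95` the iteration has entered the region where the rate is
`0.839`. -/
theorem contraction_iterate {f : ℝ → ℝ} {z : ℝ} (hz : |z| ≤ 0.035)
    (h1 : ∀ y, |y| ≤ 1.75 → |f y - z| ≤ 0.95 * |y - z|)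
    (h2 : ∀ y, |y| ≤ 0.4 → |f y - z| ≤ 0.839 * |y - z|) {u : ℕ → ℝ} (hu0 : |u 0| ≤ 1.75)
    (hu : ∀ k, u (k + 1) = f (u k)) (k : ℕ) (hk : 31 ≤ k) :
    |u k - z| ≤ 38.5 * π * 0.839 ^ k := by
  have hstart : |u 0 - z| ≤ 1.785 := (abs_sub _ _).trans (by linarith)
  have hphase1 : ∀ k, |u k| ≤ 1.75 ∧ |u k - z| ≤ 0.95 ^ k * 1.785 := by
    intro k
    induction k with
    | zero => exact ⟨hu0, by simpa using hstart⟩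
    | succ k ih =>
      have h3 := h1 _ ih.1
      rw [← hu k] at h3
      have h4 : |u k - z| ≤ 1.785 := (abs_sub _ _).trans (by linarith [ih.1])
      refine ⟨?_, ?_⟩
      · have : |u (k + 1)| ≤ |u (k + 1) - z| + |z| := by
          simpa using abs_add_le (u (k + 1) - z) z
        linarith
      · rw [pow_succ]; linarith [ih.2]
  have hbase : |u 31 - z| ≤ 0.364 := (hphase1 31).2.trans (by norm_num)
  have hphase2 : ∀ i, |u (31 + i) - z| ≤ 0.839 ^ i * 0.364 := by
    intro i
    induction i with
    | zero => simpa using hbase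
    | succ i ih =>
      have h3 : |u (31 + i) - z| ≤ 0.364 := ih.trans (mul_le_of_le_one_left (by norm_num)
        (pow_le_one₀ (by norm_num) (by norm_num)))
      have h4 : |u (31 + i)| ≤ |u (31 + i) - z| + |z| := by
        simpa using abs_add_le (u (31 + i) - z) z
      have h5 := h2 (u (31 + i)) (by linarith)
      rw [← hu (31 + i)] at h5
      rw [← add_assoc, pow_succ]
      linarith
  obtain ⟨i, rfl⟩ := Nat.exists_eq_add_of_le hk
  refine (hphase2 i).trans ?_
  have hpi := pi_gt_three
  have e : (0.364 : ℝ) ≤ 38.5 * 3 * 0.839 ^ 31 := by norm_num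
  calc (0.839 : ℝ) ^ i * 0.364 ≤ 0.839 ^ i * (38.5 * 3 * 0.839 ^ 31) := by gcongr
    _ ≤ 0.839 ^ i * (38.5 * π * 0.839 ^ 31) := by gcongr
    _ = 38.5 * π * 0.839 ^ (31 + i) := by ring

/-! ### The perturbed landscape near and away from the true frequencies -/

/-- The landscapes of two subspaces differ by the quadratic form of the difference of the
projections. -/
theorem norm_starProjection_sq_eq_add {m : ℕ} (V W : Submodule ℂ (EuclideanSpace ℂ (Fin m)))
    (v : EuclideanSpace ℂ (Fin m)) : ‖W.starProjection v‖ ^ 2 =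
      ‖V.starProjection v‖ ^ 2 + (⟪(W.starProjection - V.starProjection) v, v⟫_ℂ).re := by
  have e1 : (⟪V.starProjection v, v⟫_ℂ).re = ‖V.starProjection v‖ ^ 2 :=
    Submodule.re_inner_starProjection_eq_normSq (𝕜 := ℂ) (K := V) v
  have e2 : (⟪W.starProjection v, v⟫_ℂ).re = ‖W.starProjection v‖ ^ 2 :=
    Submodule.re_inner_starProjection_eq_normSq (𝕜 := ℂ) (K := W) v
  rw [← e1, ← e2, sub_apply, inner_sub_left, Complex.sub_re]
  ring

theorem abs_re_inner_clm_le {m : ℕ} (E : EuclideanSpace ℂ (Fin m) →L[ℂ] EuclideanSpace ℂ (Fin m))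
    {u v : EuclideanSpace ℂ (Fin m)} {a b : ℝ} (hu : ‖u‖ ≤ a) (hv : ‖v‖ ≤ b) :
    |(⟪E u, v⟫_ℂ).re| ≤ ‖E‖ * (a * b) := by
  refine (abs_re_inner_le _ _).trans ?_
  have ha : 0 ≤ a := (norm_nonneg u).trans hu
  calc ‖E u‖ * ‖v‖ ≤ (‖E‖ * ‖u‖) * ‖v‖ := by gcongr; exact E.le_opNorm u
    _ ≤ (‖E‖ * a) * b := by gcongr
    _ = ‖E‖ * (a * b) := by ring

section Landscape

variable {s m : ℕ} (x : Fin s → Torus) (j : Fin s)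
  (W : Submodule ℂ (EuclideanSpace ℂ (Fin m)))

/-- The landscape near `x j`: that of the single frequency `x j`, minus the contribution of the
other frequencies, minus the effect of replacing the Fourier subspace by `W`. -/
theorem landscape_eq (hm : 0 < m) (y : ℝ) :
    landscape W (scaledPoint m (x j) y) =
      1 - kern m y * kern m y
      - (⟪(fourierSubspace m x).starProjection (chi m 0 (m * rep (x j) / 2) y),
          (fourierSubspace m x).starProjection (chi m 0 (m * rep (x j) / 2) y)⟫_ℂ).re
      - (⟪(W.starProjection - (fourierSubspace m x).starProjection)
          (wave m 0 (m * rep (x j) / 2 + y)), wave m 0 (m * rep (x j) / 2 + y)⟫_ℂ).re := by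
  have hm' : (m : ℝ) ≠ 0 := by positivity
  have e : (m : ℝ) * (rep (x j) + 2 * y / m) / 2 = m * rep (x j) / 2 + y := by field_simp
  have e2 : ∀ v : EuclideanSpace ℂ (Fin m), (⟪v, v⟫_ℂ).re = ‖v‖ ^ 2 := fun v =>
    inner_self_eq_norm_sq (𝕜 := ℂ) v
  rw [scaledPoint, landscape_coe hm, e, norm_starProjection_sq_eq_add (fourierSubspace m x) W,
    norm_starProjection_wave_sq x j hm, e2]
  ring

/-- Near `x j` the landscape is `1 - kern²` up to a small smooth perturbation, so that it has a
local minimum close to `x j` towards which gradient descent contracts. -/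
theorem exists_localMin_near (hm : 100 ≤ m)
    (hx : ∀ j k, j ≠ k → 8 * π / m ≤ dist (x j) (x k)) (hϑ : subspaceError x W ≤ 0.01) :
    ∃ F1 : ℝ → ℝ,
      (∀ y, HasDerivAt (fun y : ℝ => landscape W (scaledPoint m (x j) y)) (F1 y) y) ∧
      ∃ z, |z| ≤ 3.5 * subspaceError x W ∧
      IsLocalMin (fun y : ℝ => landscape W (scaledPoint m (x j) y)) z ∧
      (∀ y, |y| ≤ 1.75 → |y - 1.5 * F1 y - z| ≤ 0.95 * |y - z|) ∧
      (∀ y, |y| ≤ 0.4 → |y - 1.5 * F1 y - z| ≤ 0.839 * |y - z|) := by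
  have hm0 : 0 < m := by omega
  have hland := landscape_eq x j W hm0
  have hP1 := fun y hy => norm_starProjection_chi_one_sq_le x j hm hx (y := y) hy
  have hP0 := fun y hy => norm_starProjection_chi_le x j hm hx (y := y) hy
  set η := (m : ℝ) * rep (x j) / 2
  set P := (fourierSubspace m x).starProjection with hP
  set E := W.starProjection - P with hE
  set θ := subspaceError x W with hθ
  have hEθ : ‖E‖ = θ := by rw [hθ, subspaceError, sinTheta, hE, norm_sub_rev]
  have hθ0 : 0 ≤ θ := hEθ ▸ norm_nonneg E
  have hw0 : ∀ v, ‖wave m 0 v‖ ≤ 1 := fun v => (norm_wave_zero hm0 v).le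
  have hw1 : ∀ v, ‖wave m 1 v‖ ≤ 0.57736 := fun v =>
    le_of_sq_le_sq ((norm_wave_one_sq_le hm0 v).trans (by norm_num)) (by norm_num)
  have hw2 : ∀ v, ‖wave m 2 v‖ ≤ 0.57736 := fun v =>
    le_of_sq_le_sq ((norm_wave_two_sq_le hm0 v).trans (by norm_num)) (by norm_num)
  have hP1' : ∀ y, |y| ≤ 1.75 → ‖P (chi m 1 η y)‖ ≤ 0.3163 := fun y hy =>
    le_of_sq_le_sq ((hP1 y hy).trans (by norm_num)) (by norm_num)
  have hP2 : ∀ y, ‖P (chi m 2 η y)‖ ≤ 0.57736 := fun y =>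
    (Submodule.norm_starProjection_apply_le _ _).trans ((norm_chi_le hm0 2 η y).trans (hw2 _))
  have dP : ∀ n y, HasDerivAt (fun y => P (chi m n η y)) (P (chi m (n + 1) η y)) y := fun n y =>
    (P.restrictScalars ℝ).hasFDerivAt.comp_hasDerivAt y (hasDerivAt_chi m n η y)
  have dE : ∀ n y, HasDerivAt (fun y => E (wave m n (η + y))) (E (wave m (n + 1) (η + y))) y :=
    fun n y => (E.restrictScalars ℝ).hasFDerivAt.comp_hasDerivAt y (hasDerivAt_wave_add m n η y)
  have dw := fun n y => hasDerivAt_wave_add m n η y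
  let R1 : ℝ → ℝ := fun y => (⟪P (chi m 0 η y), P (chi m 1 η y)⟫_ℂ).re +
    (⟪P (chi m 1 η y), P (chi m 0 η y)⟫_ℂ).re
  let R2 : ℝ → ℝ := fun y => ((⟪P (chi m 0 η y), P (chi m 2 η y)⟫_ℂ).re +
    (⟪P (chi m 1 η y), P (chi m 1 η y)⟫_ℂ).re) + ((⟪P (chi m 1 η y), P (chi m 1 η y)⟫_ℂ).re +
    (⟪P (chi m 2 η y), P (chi m 0 η y)⟫_ℂ).re)
  let e1 : ℝ → ℝ := fun y => (⟪E (wave m 0 (η + y)), wave m 1 (η + y)⟫_ℂ).re +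
    (⟪E (wave m 1 (η + y)), wave m 0 (η + y)⟫_ℂ).re
  let e2 : ℝ → ℝ := fun y => ((⟪E (wave m 0 (η + y)), wave m 2 (η + y)⟫_ℂ).re +
    (⟪E (wave m 1 (η + y)), wave m 1 (η + y)⟫_ℂ).re) +
    ((⟪E (wave m 1 (η + y)), wave m 1 (η + y)⟫_ℂ).re +
    (⟪E (wave m 2 (η + y)), wave m 0 (η + y)⟫_ℂ).re)
  let F1 : ℝ → ℝ := fun y => -(kern1 m y * kern m y + kern m y * kern1 m y) - R1 y - e1 y
  let F2 : ℝ → ℝ := fun y => -((kern2 m y * kern m y + kern1 m y * kern1 m y) +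
    (kern1 m y * kern1 m y + kern m y * kern2 m y)) - R2 y - e2 y
  have hF : ∀ y, HasDerivAt (fun y : ℝ => landscape W (scaledPoint m (x j) y))
      (F1 y) y := by
    intro y
    rw [funext hland]
    exact ((((hasDerivAt_kern m y).mul (hasDerivAt_kern m y)).const_sub 1).sub
      (hasDerivAt_re_inner (dP 0 y) (dP 0 y))).sub (hasDerivAt_re_inner (dE 0 y) (dw 0 y))
  have hF1 : ∀ y, HasDerivAt F1 (F2 y) y := fun y =>
    (((((hasDerivAt_kern1 m y).mul (hasDerivAt_kern m y)).add
      ((hasDerivAt_kern m y).mul (hasDerivAt_kern1 m y))).neg).sub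
      ((hasDerivAt_re_inner (dP 0 y) (dP 1 y)).add (hasDerivAt_re_inner (dP 1 y) (dP 0 y)))).sub
      ((hasDerivAt_re_inner (dE 0 y) (dw 1 y)).add (hasDerivAt_re_inner (dE 1 y) (dw 0 y)))
  have he0 : ∀ y, |(⟪E (wave m 0 (η + y)), wave m 0 (η + y)⟫_ℂ).re| ≤ θ := fun y => by
    have := abs_re_inner_clm_le E (hw0 (η + y)) (hw0 (η + y))
    rwa [mul_one, mul_one, hEθ] at this
  have he1 : ∀ y, |e1 y| ≤ 1.16 * θ := by
    intro y
    have h1 := abs_re_inner_clm_le E (hw0 (η + y)) (hw1 (η + y))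
    have h2 := abs_re_inner_clm_le E (hw1 (η + y)) (hw0 (η + y))
    rw [hEθ] at h1 h2
    exact (abs_add_le _ _).trans (by linarith)
  have he2 : ∀ y, |e2 y| ≤ 0.0183 := by
    intro y
    have h1 := abs_re_inner_clm_le E (hw0 (η + y)) (hw2 (η + y))
    have h2 := abs_re_inner_clm_le E (hw2 (η + y)) (hw0 (η + y))
    have h3 := abs_re_inner_clm_le E (hw1 (η + y)) (hw1 (η + y))
    rw [hEθ] at h1 h2 h3
    refine (abs_add_le _ _).trans ((add_le_add (abs_add_le _ _) (abs_add_le _ _)).trans ?_)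
    linarith
  have hR1 : ∀ y, |y| ≤ 1.75 → |R1 y| ≤ 0.201 * |y| := by
    intro y hy
    have h1 := abs_re_inner_le (P (chi m 0 η y)) (P (chi m 1 η y))
    have h2 := abs_re_inner_le (P (chi m 1 η y)) (P (chi m 0 η y))
    have h3 : ‖P (chi m 0 η y)‖ * ‖P (chi m 1 η y)‖ ≤ 0.3163 * |y| * 0.3163 :=
      mul_le_mul (hP0 y hy) (hP1' y hy) (norm_nonneg _) (by positivity)
    refine (abs_add_le _ _).trans ?_
    linarith [abs_nonneg y]
  have hR2 : ∀ y, |y| ≤ 0.4 → |R2 y| ≤ 0.3462 := by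
    intro y hy
    have h1 := abs_re_inner_le (P (chi m 0 η y)) (P (chi m 2 η y))
    have h2 := abs_re_inner_le (P (chi m 2 η y)) (P (chi m 0 η y))
    have h3 := abs_re_inner_le (P (chi m 1 η y)) (P (chi m 1 η y))
    have h4 := hP1 y (by linarith)
    have h5 : ‖P (chi m 0 η y)‖ ≤ 0.3163 * 0.4 := (hP0 y (by linarith)).trans (by gcongr)
    have h6 : ‖P (chi m 0 η y)‖ * ‖P (chi m 2 η y)‖ ≤ 0.3163 * 0.4 * 0.57736 :=
      mul_le_mul h5 (hP2 y) (norm_nonneg _) (by norm_num)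
    rw [← sq] at h3
    refine (abs_add_le _ _).trans ((add_le_add (abs_add_le _ _) (abs_add_le _ _)).trans ?_)
    linarith
  refine ⟨F1, hF, exists_localMin_contraction (F2 := F2) hθ0 hϑ hF hF1 ?_ ?_ ?_ ?_⟩
  · intro y hy
    obtain ⟨T, h1, h2, h3, h4⟩ := exists_slope hm hy
    refine ⟨T, h1, h2, h3, ?_⟩
    have : F1 y - y * T = -R1 y - e1 y := by rw [← h4]; simp only [F1]; ring
    rw [this]
    calc |-R1 y - e1 y| ≤ |-R1 y| + |e1 y| := abs_sub _ _
      _ ≤ _ := by rw [abs_neg]; exact add_le_add (hR1 y hy) (he1 y)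
  · intro y hy
    have hy2 : y ^ 2 ≤ 0.16 := by rw [← sq_abs]; nlinarith [abs_nonneg y]
    have h1 := one_sub_le_kern hm0 y
    have h2 := kern2_le hm y
    obtain ⟨h3, h4⟩ := abs_le.1 (abs_kern2_le hm0 y)
    have h5 := (abs_le.1 (abs_kern_le_one hm0 y)).2
    have h6 : kern1 m y ^ 2 ≤ 0.0178 := by
      have := abs_kern1_le hm0 y
      rw [← sq_abs]
      nlinarith [abs_nonneg (kern1 m y)]
    obtain ⟨h7, h8⟩ := abs_le.1 (hR2 y hy)
    obtain ⟨h9, h10⟩ := abs_le.1 (he2 y)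
    have h11 : F2 y = -2 * kern1 m y ^ 2 + 2 * (kern m y * -kern2 m y) - R2 y - e2 y := by
      simp only [F2]; ring
    have h12 : 0.9733 * 0.3066 ≤ kern m y * -kern2 m y :=
      mul_le_mul (by linarith) (by linarith) (by norm_num) (by linarith)
    have h13 : kern m y * -kern2 m y ≤ 1 * (1 / 3) :=
      mul_le_mul h5 (by linarith) (by linarith) (by norm_num)
    rw [h11]
    constructor
    · linarith
    · linarith [sq_nonneg (kern1 m y)]
  · rw [hland, kern_zero hm0, chi_zero_zero hm0, map_zero, inner_zero_left, Complex.zero_re]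
    linarith [(abs_le.1 (he0 0)).1]
  · intro y hy
    have hy2 : y ^ 2 = 0.16 := by rw [← sq_abs, hy]; norm_num
    have h1 := one_sub_le_kern hm0 y
    have h2 := kern_le_taylor hm y
    have h3 : kern m y * kern m y ≤ 0.9481 := by
      have : y ^ 4 = 0.0256 := by rw [show y ^ 4 = (y ^ 2) ^ 2 by ring, hy2]; norm_num
      nlinarith
    have h4 := abs_re_inner_le (P (chi m 0 η y)) (P (chi m 0 η y))
    have h5 : ‖P (chi m 0 η y)‖ ≤ 0.3163 * 0.4 := hy ▸ hP0 y (by linarith)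
    have h6 : ‖P (chi m 0 η y)‖ * ‖P (chi m 0 η y)‖ ≤ (0.3163 * 0.4) * (0.3163 * 0.4) :=
      mul_le_mul h5 h5 (norm_nonneg _) (by norm_num)
    rw [hland]
    linarith [(abs_le.1 (he0 y)).2, (abs_le.1 h4).2]

theorem landscape_lt_near (hm : 100 ≤ m) (hϑ : subspaceError x W ≤ 0.01) {y : ℝ}
    (hy : |y| ≤ 1 / 4) : landscape W (scaledPoint m (x j) y) < 0.529 := by
  have hm0 : 0 < m := by omega
  have hw := (norm_wave_zero hm0 (m * rep (x j) / 2 + y)).le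
  have h1 := abs_re_inner_clm_le (W.starProjection - (fourierSubspace m x).starProjection) hw hw
  have h2 : ‖W.starProjection - (fourierSubspace m x).starProjection‖ ≤ 0.01 := by
    rw [norm_sub_rev]; exact hϑ
  have h3 := one_sub_le_kern hm0 y
  have h4 : y ^ 2 ≤ 1 / 16 := by rw [← sq_abs]; nlinarith [abs_nonneg y]
  have h5 : 0.9 ≤ kern m y * kern m y := by nlinarith
  have h6 : 0 ≤ (⟪(fourierSubspace m x).starProjection (chi m 0 (m * rep (x j) / 2) y),
      (fourierSubspace m x).starProjection (chi m 0 (m * rep (x j) / 2) y)⟫_ℂ).re :=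
    inner_self_nonneg (𝕜 := ℂ)
  rw [landscape_eq x j W hm0]
  linarith [(abs_le.1 h1).1]

theorem kern_sub_sq_le (hm : 0 < m) (y δ : ℝ) (hy : |y| ≤ δ) (k : Fin s)
    (hk : δ < m * dist (x j) (x k) / 2) :
    kern m (m * rep (x j) / 2 + y - m * rep (x k) / 2) ^ 2 ≤
      1 / (m * dist (x j) (x k) / 2 - δ) ^ 2 + 1 / (m : ℝ) ^ 2 := by
  have hm' : (m : ℝ) ≠ 0 := by positivity
  have hd := dist_sub_le_norm x j y k hm
  set v := rep (x j) + 2 * y / m - rep (x k)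
  have hv : (v : Torus) ≠ 0 := by
    intro hcon
    rw [hcon, norm_zero, mul_zero, zero_div] at hd
    linarith
  have e : m * rep (x j) / 2 + y - m * rep (x k) / 2 = m * v / 2 := by
    simp only [v]; field_simp
  rw [e]
  refine (kern_sq_le_decay hm hv).trans ?_
  have : (0 : ℝ) < m * dist (x j) (x k) / 2 - δ := by linarith
  gcongr
  linarith

/-- Bound for the projection of the steering vector at scaled distance between `1.75` and `π` from
`x j`. -/
theorem norm_starProjection_wave_sq_le_of_mid (hm : 100 ≤ m)
    (hx : ∀ j k, j ≠ k → 8 * π / m ≤ dist (x j) (x k)) {y : ℝ} (hy1 : 1.75 ≤ |y|)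
    (hy2 : |y| ≤ π) :
    ‖(fourierSubspace m x).starProjection (wave m 0 (m * rep (x j) / 2 + y))‖ ^ 2 ≤ 0.46 := by
  have hm0 : 0 < m := by omega
  have hmR : (100 : ℝ) ≤ m := by exact_mod_cast hm
  have hm' : (m : ℝ) ≠ 0 := by positivity
  have hπ := pi_gt_d4
  have hframe := norm_starProjection_sq_le hm x hx (chi m 0 (m * rep (x j) / 2) y)
  rw [norm_starProjection_wave_sq x j hm0]
  have hin : ∀ k, ‖⟪wave m 0 (m * rep (x k) / 2), chi m 0 (m * rep (x j) / 2) y⟫_ℂ‖ ^ 2 =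
      (kern m (m * rep (x j) / 2 + y - m * rep (x k) / 2) -
        kern m y * kern m (m * rep (x j) / 2 - m * rep (x k) / 2)) ^ 2 := by
    intro k
    rw [chi, inner_sub_right, inner_smul_right, inner_wave, inner_wave, inner_wave,
      add_sub_cancel_left, ← Complex.ofReal_mul, ← Complex.ofReal_sub, Complex.norm_real,
      norm_eq_abs, sq_abs]
  rw [Finset.sum_congr rfl fun k _ => hin k, ← Finset.add_sum_erase _ _ (Finset.mem_univ j),
    add_sub_cancel_left, sub_self, kern_zero hm0, mul_one, sub_self, zero_pow two_ne_zero,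
    zero_add] at hframe
  have hk : kern m y ^ 2 ≤ 0.3267 := by
    have e0 : |2 * y / m| = 2 * |y| / m := by rw [abs_div, abs_mul, abs_two, Nat.abs_cast]
    have e1 : ‖((2 * y / m : ℝ) : Torus)‖ = 2 * |y| / m := by
      rw [norm_coe_torus, e0]
      rw [e0, div_le_iff₀ (by positivity)]
      nlinarith
    have hne : ((2 * y / m : ℝ) : Torus) ≠ 0 := by
      rw [← norm_pos_iff, e1]
      have : 0 < |y| := by linarith
      positivity
    have h := kern_sq_le_decay hm0 hne
    rw [e1, show (m : ℝ) * (2 * y / m) / 2 = y by field_simp,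
      show (m : ℝ) * (2 * |y| / m) / 2 = |y| by field_simp] at h
    refine h.trans ?_
    have e2 : 1 / |y| ^ 2 ≤ 1 / 1.75 ^ 2 := by gcongr
    have e3 : 1 / (m : ℝ) ^ 2 ≤ 1 / 100 ^ 2 := by gcongr
    have : (1 : ℝ) / 1.75 ^ 2 + 1 / 100 ^ 2 ≤ 0.3267 := by norm_num
    linarith
  have hterm : ∀ k ∈ Finset.univ.erase j,
      (kern m (m * rep (x j) / 2 + y - m * rep (x k) / 2) -
        kern m y * kern m (m * rep (x j) / 2 - m * rep (x k) / 2)) ^ 2 ≤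
      1.47 * (1 / (m * dist (x j) (x k) / 2 - π) ^ 2 + 1 / (m : ℝ) ^ 2) +
      3.128 * 0.3267 * (1 / (m * dist (x j) (x k) / 2) ^ 2 + 1 / (m : ℝ) ^ 2) := by
    intro k hk'
    have hjk := hx j k (Finset.ne_of_mem_erase hk').symm
    have hmd : 4 * π ≤ m * dist (x j) (x k) / 2 := by
      calc 4 * π = m * (8 * π / m) / 2 := by field_simp; ring
        _ ≤ _ := by gcongr
    have h1 := kern_sub_sq_le x j hm0 y π hy2 k (by linarith)
    have h2 := kern_sub_sq_le x j hm0 0 0 (by simp) k (by linarith)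
    rw [add_zero, sub_zero] at h2
    set a := kern m (m * rep (x j) / 2 + y - m * rep (x k) / 2)
    set b := kern m (m * rep (x j) / 2 - m * rep (x k) / 2)
    set c := kern m y
    -- Young's inequality, with weights close to the optimal ones
    have h3 : (a - c * b) ^ 2 ≤ 1.47 * a ^ 2 + 3.128 * (c ^ 2 * b ^ 2) := by
      nlinarith [sq_nonneg (0.47 * a + c * b), sq_nonneg (c * b)]
    have h4 : c ^ 2 * b ^ 2 ≤ 0.3267 * (1 / (m * dist (x j) (x k) / 2) ^ 2 + 1 / (m : ℝ) ^ 2) := by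
      gcongr
    linarith
  have hs2 := separated_sum_le hm x hx j
  have hs1 := sum_decay_le (Finset.univ.erase j) x (x j) hm (a := 8 * π / m) (δ := π)
    (A := 3 * π) (fun k _ l _ hkl => hx k l hkl)
    (fun k hk => hx j k (Finset.ne_of_mem_erase hk).symm)
    (by positivity) (by positivity) (by field_simp; ring)
  have e1 : 1 / (3 * π) ^ 2 ≤ 1 / (3 * 3.1415) ^ 2 := by gcongr
  have e2 : 1 / (4 * π * (3 * π + 2 * π)) ≤
      1 / (4 * 3.1415 * (3 * 3.1415 + 2 * 3.1415)) := by gcongr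
  have e3 : (2 : ℝ) * (1 / (3 * 3.1415) ^ 2 +
      1 / (4 * 3.1415 * (3 * 3.1415 + 2 * 3.1415))) + 0.0027 ≤ 0.0354 := by norm_num
  have hsum := Finset.sum_le_sum hterm
  rw [Finset.sum_add_distrib, ← Finset.mul_sum, ← Finset.mul_sum] at hsum
  linarith

/-- Bound for the projection of the steering vector at scaled distance at least `π` from all
frequencies. -/
theorem norm_starProjection_wave_sq_le_of_far (hm : 100 ≤ m)
    (hx : ∀ j k, j ≠ k → 8 * π / m ≤ dist (x j) (x k)) {t : Torus}
    (ht : ∀ k, 2 * π / m ≤ dist t (x k)) :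
    ‖(fourierSubspace m x).starProjection (wave m 0 (m * rep t / 2))‖ ^ 2 ≤ 0.46 := by
  have hm0 : 0 < m := by omega
  have hm' : (m : ℝ) ≠ 0 := by positivity
  have hπ := pi_gt_d4
  have hframe := norm_starProjection_sq_le hm x hx (wave m 0 (m * rep t / 2))
  have hterm : ∀ k ∈ Finset.univ,
      ‖⟪wave m 0 (m * rep (x k) / 2), wave m 0 (m * rep t / 2)⟫_ℂ‖ ^ 2 ≤
      1 / (m * dist t (x k) / 2 - 0) ^ 2 + 1 / (m : ℝ) ^ 2 := by
    intro k _
    have e1 : ((rep t - rep (x k) : ℝ) : Torus) = t - x k := by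
      rw [AddCircle.coe_sub, coe_rep, coe_rep]
    have hne : ((rep t - rep (x k) : ℝ) : Torus) ≠ 0 := by
      rw [← norm_pos_iff, e1, ← dist_eq_norm]
      exact lt_of_lt_of_le (by positivity) (ht k)
    have h := kern_sq_le_decay hm0 hne
    rw [e1, ← dist_eq_norm] at h
    rwa [inner_wave, Complex.norm_real, norm_eq_abs, sq_abs, sub_zero,
      show m * rep t / 2 - m * rep (x k) / 2 = m * (rep t - rep (x k)) / 2 by ring]
  have hs := sum_decay_le Finset.univ x t hm (a := 2 * π / m) (δ := 0)
    (A := π) (fun k _ l _ hkl => hx k l hkl) (fun k _ => ht k)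
    (by positivity) (by positivity) (by field_simp; ring)
  have e1 : 1 / π ^ 2 ≤ 1 / 3.1415 ^ 2 := by gcongr
  have e2 : 1 / (4 * π * (π + 2 * π)) ≤ 1 / (4 * 3.1415 * (3.1415 + 2 * 3.1415)) := by gcongr
  have e3 : (2 : ℝ) * (1 / 3.1415 ^ 2 + 1 / (4 * 3.1415 * (3.1415 + 2 * 3.1415))) + 0.0027
      ≤ 0.2225 := by norm_num
  have hsum := Finset.sum_le_sum hterm
  linarith

/-- Away from the frequencies the landscape exceeds the threshold. -/
theorem landscape_ge_far (hm : 100 ≤ m)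
    (hx : ∀ j k, j ≠ k → 8 * π / m ≤ dist (x j) (x k)) (hϑ : subspaceError x W ≤ 0.01) {t : Torus}
    (ht : ∀ k, 3.5 / m ≤ dist t (x k)) : 0.529 ≤ landscape W t := by
  have hm0 : 0 < m := by omega
  have hm' : (0 : ℝ) < m := by positivity
  have hP : ‖(fourierSubspace m x).starProjection (steering m t)‖ ^ 2 ≤ 0.46 := by
    by_cases h : ∀ k, 2 * π / m ≤ dist t (x k)
    · rw [steering_eq_wave hm0]
      exact norm_starProjection_wave_sq_le_of_far x hm hx h
    · push Not at h
      obtain ⟨k, hk⟩ := h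
      obtain ⟨y, hty, hy⟩ := exists_scaledPoint hm0 (x k) t
      have h1 : 1.75 ≤ |y| := by
        rw [hy]
        calc (1.75 : ℝ) = m * (3.5 / m) / 2 := by field_simp; norm_num
          _ ≤ _ := by gcongr; exact ht k
      have h2 : |y| ≤ π := by
        rw [hy]
        calc (m : ℝ) * dist t (x k) / 2 ≤ m * (2 * π / m) / 2 := by gcongr
          _ = π := by field_simp
      have h3 := norm_starProjection_wave_sq_le_of_mid x k hm hx h1 h2
      have e : (m : ℝ) * (rep (x k) + 2 * y / m) / 2 = m * rep (x k) / 2 + y := by field_simp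
      have h4 := landscape_coe hm0 (fourierSubspace m x) (rep (x k) + 2 * y / m)
      rw [← scaledPoint, ← hty, e, landscape] at h4
      linarith
  have hw : ‖steering m t‖ ≤ 1 := by rw [steering_eq_wave hm0]; exact (norm_wave_zero hm0 _).le
  have h1 := abs_re_inner_clm_le (W.starProjection - (fourierSubspace m x).starProjection) hw hw
  have h2 : ‖W.starProjection - (fourierSubspace m x).starProjection‖ ≤ 0.01 := by
    rw [norm_sub_rev]; exact hϑ
  rw [landscape, norm_starProjection_sq_eq_add (fourierSubspace m x) W]
  linarith [(abs_le.1 h1).2]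

end Landscape

/-! ### Clusters of accepted grid points -/

/-- A short arc consists of the points whose displacement lies between those of its ends. -/
theorem mem_shortArc_iff {m : ℕ} (hm : 0 < m) (p q : Torus) {a b : ℝ} (h1 : -π < 2 * (b - a) / m)
    (h2 : 2 * (b - a) / m ≤ π) : q ∈ shortArc (scaledPoint m p a) (scaledPoint m p b) ↔
      ∃ r ∈ Icc (0 : ℝ) 1, q = scaledPoint m p (a + r * (b - a)) := by
  have hm' : (m : ℝ) ≠ 0 := by positivity
  have e : ∀ r : ℝ, scaledPoint m p a + ((r * (2 * (b - a) / m) : ℝ) : Torus) =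
      scaledPoint m p (a + r * (b - a)) := by
    intro r
    rw [scaledPoint, scaledPoint, ← AddCircle.coe_add]
    congr 1; field_simp; ring
  rw [shortArc, scaledPoint_sub, rep_coe h1 h2]
  simp only [e, mem_image, eq_comm]

theorem exists_mem_of_mesh_le {G : Set Torus} (hG : G.Finite) {ε : ℝ} (hε : 0 ≤ ε)
    (h : mesh G ≤ ENNReal.ofReal ε) (t : Torus) : ∃ u ∈ G, dist t u ≤ ε := by
  have h1 : Metric.infEDist t G ≤ ENNReal.ofReal ε :=
    (le_iSup (fun t => Metric.infEDist t G) t).trans h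
  have hne : G.Nonempty := by
    rw [nonempty_iff_ne_empty]
    rintro rfl
    rw [Metric.infEDist_empty] at h1
    exact absurd h1 (by simp)
  obtain ⟨u, hu, hd⟩ := hG.isCompact.exists_infEDist_eq_edist hne t
  refine ⟨u, hu, ?_⟩
  rw [hd, edist_dist] at h1
  exact (ENNReal.ofReal_le_ofReal_iff hε).1 h1

theorem dist_le_of_minSep {s : ℕ} {x : Fin s → Torus} {D : ℝ}
    (h : ENNReal.ofReal D ≤ minSep x) (j k : Fin s) (hjk : j ≠ k) : D ≤ dist (x j) (x k) := by
  have h1 : minSep x ≤ edist (x j) (x k) :=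
    (iInf_le _ j).trans ((iInf_le _ k).trans (iInf_le _ hjk))
  have h2 := h.trans h1
  rw [edist_dist] at h2
  exact (ENNReal.ofReal_le_ofReal_iff dist_nonneg).1 h2

section Clusters

variable {s m : ℕ} {x : Fin s → Torus} {G : Set Torus} {f : Torus → ℝ} {α : ℝ}

/-- The accepted points close to `x j`. -/
def nearCluster (m : ℕ) (x : Fin s → Torus) (G : Set Torus) (f : Torus → ℝ) (α : ℝ) (j : Fin s) :
    Set Torus := accepted f G α ∩ Metric.ball (x j) (3.5 / m)

theorem exists_scaledPoint_of_mem (hm : 0 < m) {j : Fin s} {t : Torus}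
    (ht : t ∈ nearCluster m x G f α j) : ∃ y : ℝ, t = scaledPoint m (x j) y ∧ |y| < 1.75 := by
  have hm' : (0 : ℝ) < m := by positivity
  obtain ⟨y, h1, h2⟩ := exists_scaledPoint hm (x j) t
  refine ⟨y, h1, ?_⟩
  have h3 : dist t (x j) < 3.5 / m := ht.2
  rw [lt_div_iff₀ hm'] at h3
  rw [h2]; linarith

theorem nearCluster_unique (hm : 0 < m) (hx : ∀ j k, j ≠ k → 8 * π / m ≤ dist (x j) (x k))
    {j k : Fin s} {t : Torus} (hj : t ∈ nearCluster m x G f α j)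
    (hk : t ∈ nearCluster m x G f α k) : j = k := by
  by_contra h
  have h1 := hx j k h
  have h2 : dist t (x j) < 3.5 / m := hj.2
  have h3 : dist t (x k) < 3.5 / m := hk.2
  have h4 := dist_triangle_left (x j) (x k) t
  have h5 : (3.5 : ℝ) / m + 3.5 / m ≤ 8 * π / m := by
    rw [← add_div]; gcongr; linarith [pi_gt_three]
  linarith

theorem nearCluster_nonempty (hm : 0 < m)
    (hG : ∀ t, ∃ u ∈ G, dist t u ≤ 1 / (2 * (m : ℝ)))
    (hnear : ∀ j y, |y| ≤ 1 / 4 → f (scaledPoint m (x j) y) < α) (j : Fin s) :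
    (nearCluster m x G f α j).Nonempty := by
  have hm' : (0 : ℝ) < m := by positivity
  obtain ⟨u, hu, hd⟩ := hG (x j)
  obtain ⟨y, h1, h2⟩ := exists_scaledPoint hm (x j) u
  rw [dist_comm, le_div_iff₀ (by positivity)] at hd
  refine ⟨u, ⟨hu, h1 ▸ hnear j y (by rw [h2]; linarith)⟩, ?_⟩
  rw [Metric.mem_ball, lt_div_iff₀ hm']
  linarith

/-- The landscape has no interior strict maximum near `x j`, so the arc between two accepted
points near `x j` consists of points below the threshold. -/
theorem isCluster_nearCluster (hm : 100 ≤ m)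
    (hmono : ∀ j a b c, -1.75 ≤ a → a ≤ b → b ≤ c → c ≤ 1.75 →
      f (scaledPoint m (x j) b) ≤ max (f (scaledPoint m (x j) a)) (f (scaledPoint m (x j) c)))
    (j : Fin s) : IsCluster G (nearCluster m x G f α j) := by
  have hm0 : 0 < m := by omega
  have hmR : (100 : ℝ) ≤ m := by exact_mod_cast hm
  have hm' : (0 : ℝ) < m := by positivity
  refine ⟨fun v hv => hv.1.1, fun v hv w hw => ?_⟩
  obtain ⟨a, rfl, ha⟩ := exists_scaledPoint_of_mem hm0 hv
  obtain ⟨b, rfl, hb⟩ := exists_scaledPoint_of_mem hm0 hw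
  obtain ⟨ha1, ha2⟩ := abs_lt.1 ha
  obtain ⟨hb1, hb2⟩ := abs_lt.1 hb
  have hπ := pi_gt_three
  have hlen : 2 * |b - a| / m < 1 := by
    have : |b - a| < 3.5 := by rw [abs_lt]; constructor <;> linarith
    rw [div_lt_one hm']; linarith
  refine ⟨?_, ?_⟩
  · rw [dist_comm]
    exact (dist_scaledPoint_le m (x j) a b).trans_lt (by linarith)
  · rintro q ⟨hqG, hq⟩
    have habs : |2 * (b - a) / m| < 1 := by
      rwa [abs_div, abs_mul, abs_two, Nat.abs_cast]
    obtain ⟨h1, h2⟩ := abs_lt.1 habs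
    obtain ⟨r, ⟨hr0, hr1⟩, rfl⟩ := (mem_shortArc_iff hm0 (x j) q (by linarith) (by linarith)).1 hq
    have hfa : f (scaledPoint m (x j) a) < α := hv.1.2
    have hfb : f (scaledPoint m (x j) b) < α := hw.1.2
    have hy : f (scaledPoint m (x j) (a + r * (b - a))) < α ∧ |a + r * (b - a)| < 1.75 := by
      rcases le_total a b with hab | hab
      · have e1 : a ≤ a + r * (b - a) := by nlinarith
        have e2 : a + r * (b - a) ≤ b := by nlinarith
        exact ⟨(hmono j a _ b ha1.le e1 e2 hb2.le).trans_lt (max_lt hfa hfb),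
          abs_lt.2 ⟨by linarith, by linarith⟩⟩
      · have e1 : b ≤ a + r * (b - a) := by nlinarith
        have e2 : a + r * (b - a) ≤ a := by nlinarith
        exact ⟨(hmono j b _ a hb1.le e1 e2 ha2.le).trans_lt (max_lt hfb hfa),
          abs_lt.2 ⟨by linarith, by linarith⟩⟩
    refine ⟨⟨hqG, hy.1⟩, ?_⟩
    have h3 := dist_scaledPoint_le m (x j) 0 (a + r * (b - a))
    rw [scaledPoint_zero, sub_zero] at h3
    rw [Metric.mem_ball]
    refine h3.trans_lt ?_
    gcongr
    linarith [hy.2]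

/-- At scaled distance about `2 π` from `x j` all frequencies are far. -/
theorem le_of_gap (hm : 100 ≤ m) (hx : ∀ j k, j ≠ k → 8 * π / m ≤ dist (x j) (x k))
    (hfar : ∀ t, (∀ k, 3.5 / m ≤ dist t (x k)) → α ≤ f t) (j : Fin s) {c : ℝ}
    (h1 : 2 * π - 1 / 4 ≤ |c|) (h2 : |c| ≤ 2 * π + 1 / 4) : α ≤ f (scaledPoint m (x j) c) := by
  have hmR : (100 : ℝ) ≤ m := by exact_mod_cast hm
  have hm' : (0 : ℝ) < m := by positivity
  have hπ := pi_gt_three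
  have h3 : dist (scaledPoint m (x j) c) (x j) = 2 * |c| / m := by
    refine dist_scaledPoint_eq _ ?_
    rw [div_le_iff₀ hm']; nlinarith
  refine hfar _ fun k => ?_
  by_cases hk : k = j
  · rw [hk, h3]; gcongr; linarith
  · have h4 := hx j k (Ne.symm hk)
    have h5 := dist_triangle_left (x j) (x k) (scaledPoint m (x j) c)
    have h6 : (3.5 : ℝ) / m + 2 * |c| / m ≤ 8 * π / m := by
      rw [← add_div]; gcongr; linarith
    linarith

/-- A cluster cannot jump from one frequency to another: the arc between them contains a rejected
grid point. -/
theorem exists_subset_nearCluster (hm : 100 ≤ m)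
    (hx : ∀ j k, j ≠ k → 8 * π / m ≤ dist (x j) (x k))
    (hG : ∀ t, ∃ u ∈ G, dist t u ≤ 1 / (2 * (m : ℝ)))
    (hfar : ∀ t, (∀ k, 3.5 / m ≤ dist t (x k)) → α ≤ f t)
    {V : Set Torus} (hVne : V.Nonempty) (hVA : V ⊆ accepted f G α) (hV : IsCluster G V) :
    ∃ j, V ⊆ nearCluster m x G f α j := by
  have hm0 : 0 < m := by omega
  have hmR : (100 : ℝ) ≤ m := by exact_mod_cast hm
  have hm' : (0 : ℝ) < m := by positivity
  have hπ := pi_gt_three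
  have hcover : ∀ t ∈ accepted f G α, ∃ j, t ∈ nearCluster m x G f α j := by
    intro t ht
    by_contra h
    push Not at h
    refine absurd (hfar t fun k => ?_) (not_le.2 ht.2)
    by_contra hk
    push Not at hk
    exact h k ⟨ht, hk⟩
  obtain ⟨v, hv⟩ := hVne
  obtain ⟨j, hvj⟩ := hcover v (hVA hv)
  refine ⟨j, fun w hw => ?_⟩
  obtain ⟨k, hwk⟩ := hcover w (hVA hw)
  by_cases hkj : k = j
  · exact hkj ▸ hwk
  exfalso
  obtain ⟨a, rfl, ha⟩ := exists_scaledPoint_of_mem hm0 hvj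
  obtain ⟨ha1, ha2⟩ := abs_lt.1 ha
  obtain ⟨hd, harc⟩ := hV.2 _ hv w hw
  set ρ := rep (w - scaledPoint m (x j) a) with hρ
  have hρπ : |ρ| < π := by rw [hρ, abs_rep, ← dist_eq_norm, dist_comm]; exact hd
  set b := a + m * ρ / 2 with hb
  have hba : 2 * (b - a) / m = ρ := by rw [hb]; field_simp; ring
  have hwb : w = scaledPoint m (x j) b := by
    have := scaledPoint_sub m (x j) a b
    rw [hba, hρ, coe_rep] at this
    exact (sub_left_injective this).symm
  have hb10 : 10 < |b| := by
    have h1 := hx j k (Ne.symm hkj)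
    have h2 : dist w (x k) < 3.5 / m := hwk.2
    have h3 := dist_scaledPoint_le m (x j) 0 b
    rw [scaledPoint_zero, sub_zero, ← hwb] at h3
    have h4 := dist_triangle_left (x j) (x k) w
    have h5 : 8 * π / m < (2 * |b| + 3.5) / m := by rw [add_div]; linarith
    rw [div_lt_div_iff_of_pos_right hm'] at h5
    linarith
  -- grid points near `x j ± 4 π / m` are rejected
  have hgrid : ∀ c0 : ℝ, |c0| = 2 * π → ∃ c, |c - c0| ≤ 1 / 4 ∧ scaledPoint m (x j) c ∈ G ∧
      α ≤ f (scaledPoint m (x j) c) := by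
    intro c0 hc0
    obtain ⟨u, hu, hdu⟩ := hG (scaledPoint m (x j) c0)
    set c := c0 + m * rep (u - scaledPoint m (x j) c0) / 2 with hc
    have hcu : u = scaledPoint m (x j) c := by
      have := scaledPoint_sub m (x j) c0 c
      rw [show 2 * (c - c0) / m = rep (u - scaledPoint m (x j) c0) by rw [hc]; field_simp; ring,
        coe_rep] at this
      exact (sub_left_injective this).symm
    have hcc : |c - c0| ≤ 1 / 4 := by
      rw [dist_comm, dist_eq_norm, ← abs_rep, le_div_iff₀ (by positivity)] at hdu
      rw [hc, add_sub_cancel_left, abs_div, abs_mul, abs_two, Nat.abs_cast]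
      linarith
    refine ⟨c, hcc, hcu ▸ hu, le_of_gap hm hx hfar j ?_ ?_⟩
    · have := abs_sub_abs_le_abs_sub c0 c
      rw [abs_sub_comm] at this
      linarith
    · have := abs_sub_abs_le_abs_sub c c0
      linarith
  have hcontra : ∀ c, (a < c ∧ c < b ∨ b < c ∧ c < a) → scaledPoint m (x j) c ∈ G →
      α ≤ f (scaledPoint m (x j) c) → False := by
    intro c hc hcG hcα
    have hmem : scaledPoint m (x j) c ∈ V := by
      refine harc ⟨hcG, ?_⟩
      obtain ⟨h1, h2⟩ := abs_lt.1 hρπ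
      rw [hwb, mem_shortArc_iff hm0 (x j) _ (by rwa [hba]) (by rw [hba]; exact h2.le)]
      have hne : b - a ≠ 0 := by
        rcases hc with h | h
        · exact (by linarith : 0 < b - a).ne'
        · exact (by linarith : b - a < 0).ne
      refine ⟨(c - a) / (b - a), ?_, by rw [div_mul_cancel₀ _ hne]; congr 1; ring⟩
      rcases hc with h | h
      · exact ⟨div_nonneg (by linarith) (by linarith), (div_le_one (by linarith)).2 (by linarith)⟩
      · exact ⟨div_nonneg_of_nonpos (by linarith) (by linarith),
          (div_le_one_of_neg (by linarith)).2 (by linarith)⟩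
    exact absurd (hVA hmem).2 (not_lt.2 hcα)
  have hπ4 := pi_lt_d4
  rcases lt_abs.1 hb10 with h | h
  · obtain ⟨c, h1, h2, h3⟩ := hgrid (2 * π) (abs_of_pos (by positivity))
    obtain ⟨h4, h5⟩ := abs_le.1 h1
    exact hcontra c (Or.inl ⟨by linarith, by linarith⟩) h2 h3
  · obtain ⟨c, h1, h2, h3⟩ := hgrid (-(2 * π)) (by rw [abs_neg]; exact abs_of_pos (by positivity))
    obtain ⟨h4, h5⟩ := abs_le.1 h1
    exact hcontra c (Or.inr ⟨by linarith, by linarith⟩) h2 h3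

theorem sUnion_range_nearCluster
    (hfar : ∀ t, (∀ k, 3.5 / m ≤ dist t (x k)) → α ≤ f t) :
    ⋃₀ range (nearCluster m x G f α) = accepted f G α := by
  refine Subset.antisymm (sUnion_subset ?_) fun t ht => ?_
  · rintro _ ⟨j, rfl⟩
    exact inter_subset_left
  · by_contra h
    refine absurd (hfar t fun k => ?_) (not_le.2 ht.2)
    by_contra hk
    push Not at hk
    exact h ⟨_, ⟨k, rfl⟩, ht, hk⟩

theorem clustersOf_eq_range (hm : 100 ≤ m)
    (hx : ∀ j k, j ≠ k → 8 * π / m ≤ dist (x j) (x k))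
    (hG : ∀ t, ∃ u ∈ G, dist t u ≤ 1 / (2 * (m : ℝ)))
    (hfar : ∀ t, (∀ k, 3.5 / m ≤ dist t (x k)) → α ≤ f t)
    (hnear : ∀ j y, |y| ≤ 1 / 4 → f (scaledPoint m (x j) y) < α)
    (hmono : ∀ j a b c, -1.75 ≤ a → a ≤ b → b ≤ c → c ≤ 1.75 →
      f (scaledPoint m (x j) b) ≤ max (f (scaledPoint m (x j) a)) (f (scaledPoint m (x j) c))) :
    clustersOf G (accepted f G α) = range (nearCluster m x G f α) := by
  have hm0 : 0 < m := by omega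
  have hcl := isCluster_nearCluster (G := G) (α := α) hm hmono
  ext V
  constructor
  · rintro ⟨hne, hmax⟩
    obtain ⟨j, hj⟩ := exists_subset_nearCluster hm hx hG hfar hne hmax.prop.1 hmax.prop.2
    exact ⟨j, (hmax.eq_of_subset ⟨inter_subset_left, hcl j⟩ hj).symm⟩
  · rintro ⟨j, rfl⟩
    have hne := nearCluster_nonempty hm0 hG hnear j
    refine ⟨hne, ⟨inter_subset_left, hcl j⟩, fun V hV hjV => ?_⟩
    obtain ⟨k, hk⟩ := exists_subset_nearCluster hm hx hG hfar (hne.mono hjV) hV.1 hV.2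
    obtain ⟨t, ht⟩ := hne
    rwa [nearCluster_unique hm0 hx ht (hk (hjV ht))]

theorem nearCluster_injective (hm : 0 < m)
    (hx : ∀ j k, j ≠ k → 8 * π / m ≤ dist (x j) (x k))
    (hG : ∀ t, ∃ u ∈ G, dist t u ≤ 1 / (2 * (m : ℝ)))
    (hnear : ∀ j y, |y| ≤ 1 / 4 → f (scaledPoint m (x j) y) < α) :
    Function.Injective (nearCluster m x G f α) := by
  intro j k hjk
  obtain ⟨t, ht⟩ := nearCluster_nonempty hm hG hnear j
  exact nearCluster_unique hm hx ht (hjk ▸ ht)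

end Clusters

/-! ### Gradient descent on the torus -/

theorem torusDeriv_scaledPoint {m : ℕ} (hm : 0 < m) {f : Torus → ℝ} {p : Torus} {F1 : ℝ → ℝ}
    (hF : ∀ y, HasDerivAt (fun y => f (scaledPoint m p y)) (F1 y) y) (y : ℝ) :
    torusDeriv f (scaledPoint m p y) = F1 y * (m / 2) := by
  have hm' : (m : ℝ) ≠ 0 := by positivity
  have e : (fun u : ℝ => f (scaledPoint m p y + (u : Torus))) =
      fun u : ℝ => f (scaledPoint m p (y + u * (m / 2))) := by
    funext u
    congr 1
    rw [scaledPoint, scaledPoint, ← AddCircle.coe_add]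
    congr 1; field_simp; ring
  have h1 : HasDerivAt (fun u : ℝ => y + u * (m / 2)) (1 * ((m : ℝ) / 2)) 0 :=
    ((hasDerivAt_id (0 : ℝ)).mul_const ((m : ℝ) / 2)).const_add y
  have h2 : HasDerivAt (fun y => f (scaledPoint m p y)) (F1 y) (y + 0 * (m / 2)) := by
    simpa using hF y
  have h3 := (h2.comp (0 : ℝ) h1).deriv
  rw [torusDeriv, e]
  rw [one_mul] at h3
  exact h3

/-- In the scaled variable the step size `6 / m²` becomes `(6 / m²) (m / 2)² = 1.5`. -/
theorem gradIter_scaledPoint {m : ℕ} (hm : 0 < m) {f : Torus → ℝ} {p : Torus} {F1 : ℝ → ℝ}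
    (hF : ∀ y, HasDerivAt (fun y => f (scaledPoint m p y)) (F1 y) y) (y : ℝ) (k : ℕ) :
    gradIter f (6 / (m : ℝ) ^ 2) (scaledPoint m p y) k =
      scaledPoint m p ((fun y => y - 1.5 * F1 y)^[k] y) := by
  have hm' : (m : ℝ) ≠ 0 := by positivity
  induction k with
  | zero => rfl
  | succ k ih =>
    rw [gradIter, ih, torusDeriv_scaledPoint hm hF, Function.iterate_succ_apply', scaledPoint,
      scaledPoint, ← AddCircle.coe_sub]
    congr 1; field_simp; ring

theorem isLocalMin_scaledPoint {m : ℕ} (hm : 0 < m) {f : Torus → ℝ} {p : Torus} {z : ℝ}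
    (h : IsLocalMin (fun y => f (scaledPoint m p y)) z) : IsLocalMin f (scaledPoint m p z) := by
  have hm' : (2 / m : ℝ) ≠ 0 := by positivity
  have hopen : IsOpenMap (scaledPoint m p) := by
    have e : scaledPoint m p = (fun u : ℝ => (u : Torus)) ∘
        ((Homeomorph.mulLeft₀ (2 / m : ℝ) hm').trans (Homeomorph.addLeft (rep p))) := by
      funext y
      simp only [scaledPoint, Function.comp, Homeomorph.trans_apply, Homeomorph.coe_mulLeft₀,
        Homeomorph.coe_addLeft]
      congr 1; ring
    rw [e]
    exact (QuotientAddGroup.isOpenMap_coe).comp (Homeomorph.isOpenMap _)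
  exact hopen.nhds_le z h

/-- If gradient steps of size `1.5` approach `z`, then the function decreases up to `z` and
increases afterwards. -/
theorem le_max_of_contraction {F F1 : ℝ → ℝ} {z r : ℝ} (hF : ∀ y, HasDerivAt F (F1 y) y)
    (h : ∀ y, |y| ≤ r → |y - 1.5 * F1 y - z| ≤ 0.95 * |y - z|) {a b c : ℝ}
    (ha : -r ≤ a) (hab : a ≤ b) (hbc : b ≤ c) (hc : c ≤ r) : F b ≤ max (F a) (F c) := by
  have hcont : Continuous F := continuous_iff_continuousAt.2 fun y => (hF y).continuousAt
  -- a step from `y` moves towards `z`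
  have hsign : ∀ y, |y| ≤ r → (z ≤ y → 0 ≤ F1 y) ∧ (y ≤ z → F1 y ≤ 0) := by
    intro y hy
    have h1 := h y hy
    constructor
    · intro hzy
      rw [abs_of_nonneg (by linarith : 0 ≤ y - z)] at h1
      linarith [(abs_le.1 h1).2]
    · intro hzy
      rw [abs_of_nonpos (by linarith : y - z ≤ 0)] at h1
      linarith [(abs_le.1 h1).1]
  rcases le_total b z with hbz | hbz
  · refine le_max_of_le_left ?_
    have hanti : AntitoneOn F (Icc a b) := by
      refine antitoneOn_of_deriv_nonpos (convex_Icc a b) hcont.continuousOn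
        (fun y _ => (hF y).differentiableAt.differentiableWithinAt) fun y hy => ?_
      rw [interior_Icc] at hy
      rw [(hF y).deriv]
      exact (hsign y (abs_le.2 ⟨by linarith [hy.1], by linarith [hy.2]⟩)).2 (by linarith [hy.2])
    exact hanti (left_mem_Icc.2 hab) (right_mem_Icc.2 hab) hab
  · refine le_max_of_le_right ?_
    have hmono : MonotoneOn F (Icc b c) := by
      refine monotoneOn_of_deriv_nonneg (convex_Icc b c) hcont.continuousOn
        (fun y _ => (hF y).differentiableAt.differentiableWithinAt) fun y hy => ?_
      rw [interior_Icc] at hy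
      rw [(hF y).deriv]
      exact (hsign y (abs_le.2 ⟨by linarith [hy.1], by linarith [hy.2]⟩)).1 (by linarith [hy.1])
    exact hmono (left_mem_Icc.2 hbc) (right_mem_Icc.2 hbc) hbc

end GradientMUSIC

open GradientMUSIC in
theorem mainTheorem2 (m : ℕ) (hm : 100 ≤ m) (α : ℝ) (hα : α = 0.529)
    (G : Set Torus) (hG : G.Finite) (hmesh : mesh G ≤ ENNReal.ofReal (1 / (2 * (m : ℝ))))
    (h : ℝ) (hh : h = 6 / (m : ℝ) ^ 2)
    (s : ℕ) (x : Fin s → Torus) (hx : ENNReal.ofReal (8 * π / (m : ℝ)) ≤ minSep x)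
    (W : Submodule ℂ (EuclideanSpace ℂ (Fin m))) (hW : Module.finrank ℂ W = s)
    (ϑ : ℝ) (hϑ_def : ϑ = subspaceError x W) (hϑ : ϑ ≤ 0.01) :
    -- the accepted points form exactly `s` clusters, which are disjoint and exhaust them
    (clustersOf G (accepted (landscape W) G α)).encard = s ∧
    (clustersOf G (accepted (landscape W) G α)).PairwiseDisjoint id ∧
    ⋃₀ clustersOf G (accepted (landscape W) G α) = accepted (landscape W) G α ∧
    -- gradient descent from any representative of the `j`-th cluster converges linearly to a
    -- local minimum of the landscape function close to `x j`
    (∃ (C : Fin s → Set Torus) (xt : Fin s → Torus),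
      Function.Injective C ∧ range C = clustersOf G (accepted (landscape W) G α) ∧
      ∀ j, IsLocalMin (landscape W) (xt j) ∧ dist (x j) (xt j) ≤ 7 * ϑ / m ∧
        ∀ t₀ ∈ C j, ∀ k : ℕ, 31 ≤ k →
          dist (gradIter (landscape W) h t₀ k) (xt j) ≤ 77 * π * (0.839 : ℝ) ^ k / m) ∧
    -- the algorithm has an output, and each of its outputs satisfies the error bound once it is
    -- indexed to match `x`
    (∀ n : ℕ, 31 ≤ n →
      (∃ xhat : Fin s → Torus, IsOutput s W G α h n xhat) ∧
      ∀ xhat : Fin s → Torus, IsOutput s W G α h n xhat →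
        ∃ σ : Equiv.Perm (Fin s), ∀ j,
          dist (x j) (xhat (σ j)) ≤ 7 * ϑ / m + 77 * π * (0.839 : ℝ) ^ n / m) := by
  subst hα hh hϑ_def
  have hm0 : 0 < m := by omega
  have hm' : (0 : ℝ) < m := by positivity
  have hsep : ∀ j k, j ≠ k → 8 * π / m ≤ dist (x j) (x k) := dist_le_of_minSep hx
  have hgrid := exists_mem_of_mesh_le hG (by positivity) hmesh
  have hfar : ∀ t, (∀ k, 3.5 / m ≤ dist t (x k)) → 0.529 ≤ landscape W t := fun t ht =>
    landscape_ge_far x W hm hsep hϑ ht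
  have hnear : ∀ j y, |y| ≤ 1 / 4 → landscape W (scaledPoint m (x j) y) < 0.529 := fun j y hy =>
    landscape_lt_near x j W hm hϑ hy
  choose F1 hF z hz hloc hc1 hc2 using fun j => exists_localMin_near x j W hm hsep hϑ
  have hmono : ∀ j a b c, -1.75 ≤ a → a ≤ b → b ≤ c → c ≤ 1.75 →
      landscape W (scaledPoint m (x j) b) ≤
        max (landscape W (scaledPoint m (x j) a)) (landscape W (scaledPoint m (x j) c)) :=
    fun j a b c ha hab hbc hc => le_max_of_contraction (hF j) (hc1 j) ha hab hbc hc
  have hclusters := clustersOf_eq_range hm hsep hgrid hfar hnear hmono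
  have hinj := nearCluster_injective hm0 hsep hgrid hnear
  have hmin : ∀ j, dist (x j) (scaledPoint m (x j) (z j)) ≤ 7 * subspaceError x W / m := by
    intro j
    have h := dist_scaledPoint_le m (x j) 0 (z j)
    rw [scaledPoint_zero, sub_zero, dist_comm] at h
    refine h.trans (div_le_div_of_nonneg_right ?_ hm'.le)
    linarith [hz j]
  have hconv : ∀ j, ∀ t₀ ∈ nearCluster m x G (landscape W) 0.529 j, ∀ k : ℕ, 31 ≤ k →
      dist (gradIter (landscape W) (6 / (m : ℝ) ^ 2) t₀ k) (scaledPoint m (x j) (z j)) ≤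
        77 * π * (0.839 : ℝ) ^ k / m := by
    intro j t₀ ht₀ k hk
    obtain ⟨y, rfl, hy⟩ := exists_scaledPoint_of_mem hm0 ht₀
    rw [gradIter_scaledPoint hm0 (hF j)]
    refine (dist_scaledPoint_le _ _ _ _).trans ?_
    have h := contraction_iterate (u := fun k => (fun y => y - 1.5 * F1 j y)^[k] y)
      ((hz j).trans (by linarith)) (hc1 j) (hc2 j) hy.le
      (fun k => Function.iterate_succ_apply' _ k y) k hk
    refine div_le_div_of_nonneg_right ?_ hm'.le
    linarith
  rw [hclusters]
  refine ⟨?_, ?_, sUnion_range_nearCluster hfar, ⟨nearCluster m x G (landscape W) 0.529,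
    fun j => scaledPoint m (x j) (z j), hinj, rfl, fun j =>
    ⟨isLocalMin_scaledPoint hm0 (hloc j), hmin j, hconv j⟩⟩, fun n hn => ⟨?_, ?_⟩⟩
  · rw [← image_univ, hinj.encard_image, encard_univ]; simp
  · rintro _ ⟨j, rfl⟩ _ ⟨k, rfl⟩ hjk
    refine Set.disjoint_left.2 fun t ht ht' => hjk ?_
    rw [nearCluster_unique hm0 hsep ht ht']
  · choose t₀ ht₀ using nearCluster_nonempty hm0 hgrid hnear
    exact ⟨fun j => gradIter (landscape W) (6 / (m : ℝ) ^ 2) (t₀ j) n, _, t₀, hinj,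
      hclusters.symm, fun j => ⟨ht₀ j, rfl⟩⟩
  · rintro xhat ⟨C, t₀, hC, hCr, hout⟩
    rw [hclusters] at hCr
    -- match the enumeration of the clusters with that of the frequencies
    have hσ : ∀ j, ∃ i, C i = nearCluster m x G (landscape W) 0.529 j := fun j => by
      have : nearCluster m x G (landscape W) 0.529 j ∈ range C := hCr ▸ mem_range_self j
      exact this
    choose σ hσ using hσ
    have hσinj : Function.Injective σ := fun j k hjk => hinj (by rw [← hσ, ← hσ, hjk])
    refine ⟨Equiv.ofBijective σ (Finite.injective_iff_bijective.1 hσinj), fun j => ?_⟩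
    obtain ⟨h1, h2⟩ := hout (σ j)
    rw [Equiv.ofBijective_apply, h2]
    rw [hσ] at h1
    refine (dist_triangle_right _ _ (scaledPoint m (x j) (z j))).trans ?_
    exact add_le_add (hmin j) (hconv j _ h1 n hn)
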